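/- An FGCCHA is a graded cocommutative complex Hopf algebra $H=\bigoplus_{n\ge 0}H_n$ that is freely generated, as an algebra, by a graded subset $X=\biguplus_{n\ge1}X^{(n)}$ with $X^{(n)}\subseteq H_n$. Write $\mathcal P(H)=\{x\in H:\Delta(x)=x\otimes 1+1\otimes x\}$, $\mathcal P(H)_n=\mathcal P(H)\cap H_n$, and let $[\mathcal P(H),\mathcal P(H)]_n$ be the span of the commutators $xy-yx$ with $x\in\mathcal P(H)_i$, $y\in\mathcal P(H)_j$, $i+j=n$. An ordered primitive generating set of $H$ is a sequence $\vec A=\big((\alpha^{(n)}_1,\dots,\alpha^{(n)}_{\ell_n})\big)_{n\ge1}$ of finite tuples with $\alpha^{(n)}_i\in\mathcal P(H)_n$ whose entries freely generate the algebra $H$; $\operatorname{OPG}(H)$ is the set of all of them. For $\vec a=(a_n)_{n\ge1}\in\mathbb N^{\mathbb Z_+}$ let $X_{\vec a}=\{x^{(n)}_i: n\ge1,\ 1\le i\le a_n\}$ with $\deg x^{(n)}_i=n$, let $\mathfrak L(\vec a)$ be the free Lie algebra on $X_{\vec a}$, that is, the smallest subspace of the tensor algebra $\mathsf T(\mathbb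 C X_{\vec a})$ that contains $X_{\vec a}$ and is closed under the commutator, and let $\mathcal U(\mathfrak L(\vec a))$ be its universal enveloping algebra, a graded Hopf algebra in which the elements of $\mathfrak L(\vec a)$ are primitive. **Theorem.** Let $H$ be an FGCCHA with all $H_n$ finite-dimensional, and let $h_n=\dim H_n$ for $n\ge1$. Then there are sequences $\vec a=(a_n)_{n\ge1}$ and $\vec p=(p_n)_{n\ge1}$ of nonnegative integers (necessarily unique) with $$1+\sum_{k\ge1}h_kt^k=\frac1{1-\sum_{m\ge1}a_mt^m}=\prod_{d\ge1}\frac1{(1-t^d)^{p_d}}$$ in $\mathbb Q[\![t]\!]$ (so $\vec a$ is the INVERTi transform and $\vec p$ the inverse Euler transform of $\vec h$). They satisfy $a_n\le p_n$ for all $n\ge1$, and the following hold. 1. The map $$\Gamma:\{\text{graded Hopf algebra isomorphisms }\mathcal U(\mathfrak L(\vec a))\to H\}\to\operatorname{OPG}(H),\qquad \phi\mapsto\phi(X_{\vec a})=\big((\phi(x^{(n)}_1),\dots,\phi(x^{(n)}_{a_n}))\big)_{n\ge1},$$ is a well-defined bijection. 2. $\operatorname{OPG}(H)$ is nonempty and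 $\dim[\mathcal P(H),\mathcal P(H)]_n=p_n-a_n$ for all $n\ge1$. For every $\vec A=\big((\alpha^{(n)}_1,\dots,\alpha^{(n)}_{a_n})\big)_{n\ge1}\in\operatorname{OPG}(H)$ and every choice of bases $v^{(n)}_1,\dots,v^{(n)}_{p_n-a_n}$ of $[\mathcal P(H),\mathcal P(H)]_n$, $n\ge1$, the elements $\alpha^{(n)}_1,\dots,\alpha^{(n)}_{a_n},v^{(n)}_1,\dots,v^{(n)}_{p_n-a_n}$ form a basis of $\mathcal P(H)_n$ for each $n\ge1$ (so $\dim\mathcal P(H)_n=p_n$), and there is a bijection $$\Xi:\operatorname{OPG}(H)\to\Big\{\big(M^{(n)}\in\mathrm{Mat}_{a_n\times p_n}(\mathbb C)\big)_{n\ge1}:\ \det\big((M^{(n)}_{i,j})_{1\le i,j\le a_n}\big)\ne0\text{ for all }n\ge1\Big\}$$ which maps $\vec B=\big((\beta^{(n)}_1,\dots,\beta^{(n)}_{a_n})\big)_{n\ge1}$ to the matrices $M^{(n)}$ whose rows are the coordinates of the $\beta^{(n)}_i$ in these bases: $$\beta^{(n)}_i=\sum_{j=1}^{a_n}M^{(n)}_{i,j}\alpha^{(n)}_j+\sum_{j=1}^{p_n-a_n}M^{(n)}_{i,a_n+j}v^{(n)}_j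 .$$ -/

import Mathlib

open scoped TensorProduct

attribute [local instance 100] LieRing.ofAssociativeRing

/-! ### The Hopf algebra structure on a universal enveloping algebra -/

namespace UniversalEnvelopingAlgebra

section HopfStructure

variable (R : Type*) (L : Type*) [CommRing R] [LieRing L] [LieAlgebra R L]

/-- The algebra map `U(L) → U(L) ⊗ U(L)` with `x ↦ x ⊗ 1 + 1 ⊗ x` for `x ∈ L`. -/
noncomputable def comulHom :
    UniversalEnvelopingAlgebra R L →ₐ[R]
      UniversalEnvelopingAlgebra R L ⊗[R] UniversalEnvelopingAlgebra R L :=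
  lift R
    { toFun := fun x => ι R x ⊗ₜ[R] 1 + 1 ⊗ₜ[R] ι R x
      map_add' := fun x y => by
        simp only [map_add, TensorProduct.add_tmul, TensorProduct.tmul_add]; abel
      map_smul' := fun r x => by
        simp only [map_smul, RingHom.id_apply, smul_add, TensorProduct.smul_tmul',
          TensorProduct.tmul_smul]
      map_lie' := fun {x y} => by
        simp only [LieHom.map_lie, LieRing.of_associative_ring_bracket, TensorProduct.sub_tmul,
          TensorProduct.tmul_sub, add_mul, mul_add, Algebra.TensorProduct.tmul_mul_tmul,
          one_mul, mul_one]
        abel }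

/-- The algebra map `U(L) → R` with `x ↦ 0` for `x ∈ L`. -/
noncomputable def counitHom : UniversalEnvelopingAlgebra R L →ₐ[R] R := lift R 0

/-- The algebra map `U(L) → U(L)ᵐᵒᵖ` with `x ↦ -x` for `x ∈ L`. -/
noncomputable def antipodeHom :
    UniversalEnvelopingAlgebra R L →ₐ[R] (UniversalEnvelopingAlgebra R L)ᵐᵒᵖ :=
  lift R
    { toFun := fun x => MulOpposite.op (-ι R x)
      map_add' := fun x y => by
        simp only [map_add, neg_add, MulOpposite.op_add]
      map_smul' := fun r x => by
        simp only [map_smul, RingHom.id_apply, ← smul_neg, MulOpposite.op_smul]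
      map_lie' := fun {x y} => by
        simp only [LieHom.map_lie, LieRing.of_associative_ring_bracket, ← MulOpposite.op_mul,
          ← MulOpposite.op_sub, neg_mul_neg, neg_sub] }

variable {L}

@[simp] theorem comulHom_ι (x : L) :
    comulHom R L (ι R x) = ι R x ⊗ₜ[R] 1 + 1 ⊗ₜ[R] ι R x :=
  lift_ι_apply R _ x

@[simp] theorem counitHom_ι (x : L) : counitHom R L (ι R x) = 0 :=
  lift_ι_apply R _ x

@[simp] theorem antipodeHom_ι (x : L) :
    antipodeHom R L (ι R x) = MulOpposite.op (-ι R x) :=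
  lift_ι_apply R _ x

theorem algHom_ext_of_ι {A : Type*} [Ring A] [Algebra R A]
    {f g : UniversalEnvelopingAlgebra R L →ₐ[R] A}
    (h : ∀ x : L, f (ι R x) = g (ι R x)) : f = g := by
  apply hom_ext R
  apply LieHom.ext
  intro x
  exact h x

noncomputable instance instBialgebra : Bialgebra R (UniversalEnvelopingAlgebra R L) :=
  Bialgebra.ofAlgHom (comulHom R L) (counitHom R L)
    (by
      apply algHom_ext_of_ι
      intro x
      simp [-ι_apply, TensorProduct.add_tmul, TensorProduct.tmul_add,
        Algebra.TensorProduct.one_def]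
      abel)
    (by
      apply algHom_ext_of_ι
      intro x
      simp [-ι_apply])
    (by
      apply algHom_ext_of_ι
      intro x
      simp [-ι_apply])

theorem comul_apply (u : UniversalEnvelopingAlgebra R L) :
    Coalgebra.comul (R := R) u = comulHom R L u := rfl

theorem counit_apply (u : UniversalEnvelopingAlgebra R L) :
    Coalgebra.counit (R := R) u = counitHom R L u := rfl

/-- `U(L)` is spanned by products of elements of `L`. -/
theorem adjoin_range_ι :
    Algebra.adjoin R (Set.range (ι R : L → UniversalEnvelopingAlgebra R L)) = ⊤ := by
  set S := Algebra.adjoin R (Set.range (ι R : L → UniversalEnvelopingAlgebra R L)) with hS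
  let f : L →ₗ⁅R⁆ S :=
    { toFun := fun x => ⟨ι R x, Algebra.subset_adjoin ⟨x, rfl⟩⟩
      map_add' := fun x y => Subtype.ext (map_add (ι R) x y)
      map_smul' := fun r x => Subtype.ext (map_smul (ι R) r x)
      map_lie' := fun {x y} => Subtype.ext (LieHom.map_lie (ι R) x y) }
  have h : S.val.comp (lift R f) = AlgHom.id R _ := by
    apply algHom_ext_of_ι
    intro x
    rw [AlgHom.comp_apply, lift_ι_apply]
    rfl
  rw [eq_top_iff]
  intro u _
  have hu : S.val (lift R f u) = u := congrArg (fun g => g u) h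
  rw [← hu]
  exact (lift R f u).2

theorem span_closure_range_ι :
    Submodule.span R
      (Submonoid.closure (Set.range (ι R : L → UniversalEnvelopingAlgebra R L)) :
        Set (UniversalEnvelopingAlgebra R L)) = ⊤ := by
  rw [← Algebra.adjoin_eq_span, adjoin_range_ι, Algebra.top_toSubmodule]

/-- The antipode of `U(L)`: the anti-automorphism with `x ↦ -x` for `x ∈ L`. -/
noncomputable def antipodeLin :
    UniversalEnvelopingAlgebra R L →ₗ[R] UniversalEnvelopingAlgebra R L :=
  (MulOpposite.opLinearEquiv R).symm.toLinearMap ∘ₗ (antipodeHom R L).toLinearMap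

theorem antipodeLin_ι (x : L) : antipodeLin R (ι R x) = -ι R x := by
  simp [antipodeLin, -ι_apply]

theorem antipodeLin_mul (u v : UniversalEnvelopingAlgebra R L) :
    antipodeLin R (u * v) = antipodeLin R v * antipodeLin R u := by
  simp [antipodeLin]

theorem antipodeLin_one :
    antipodeLin R (1 : UniversalEnvelopingAlgebra R L) = 1 := by
  simp [antipodeLin]

noncomputable instance instHopfAlgebra : HopfAlgebra R (UniversalEnvelopingAlgebra R L) where
  antipode := antipodeLin R
  mul_antipode_rTensor_comul := by
    apply LinearMap.ext_on (span_closure_range_ι R)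
    intro u hu
    induction hu using Submonoid.closure_induction_left with
    | one =>
      simp [Algebra.TensorProduct.one_def, antipodeLin_one]
    | mul_left a ha v hv ih =>
      obtain ⟨x, rfl⟩ := ha
      simp only [LinearMap.comp_apply, comul_apply, counit_apply, map_mul, comulHom_ι,
        counitHom_ι, zero_mul, map_zero]
      generalize comulHom R L v = t
      induction t with
      | zero => simp
      | add s t hs ht => rw [mul_add, map_add, map_add, hs, ht, add_zero]
      | tmul p q =>
        simp [-ι_apply, add_mul, antipodeLin_mul, antipodeLin_ι, mul_assoc]
  mul_antipode_lTensor_comul := by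
    apply LinearMap.ext_on (span_closure_range_ι R)
    intro u hu
    induction hu using Submonoid.closure_induction_right with
    | one =>
      simp [Algebra.TensorProduct.one_def, antipodeLin_one]
    | mul_right v hv a ha ih =>
      obtain ⟨x, rfl⟩ := ha
      simp only [LinearMap.comp_apply, comul_apply, counit_apply, map_mul, comulHom_ι,
        counitHom_ι, mul_zero, map_zero]
      generalize comulHom R L v = t
      induction t with
      | zero => simp
      | add s t hs ht => rw [add_mul, map_add, map_add, hs, ht, add_zero]
      | tmul p q =>
        simp [-ι_apply, mul_add, antipodeLin_mul, antipodeLin_ι, mul_assoc]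

end HopfStructure

/-- The grading of `U(L)` induced by a grading `ℒ` of `L`: the degree `n` part is spanned by the
products `x₁ ⋯ x_k` of homogeneous elements of `L` whose degrees add up to `n`. -/
def gradedPart {R L : Type*} [CommRing R] [LieRing L] [LieAlgebra R L]
    (ℒ : ℕ → Submodule R L) (n : ℕ) : Submodule R (UniversalEnvelopingAlgebra R L) :=
  Submodule.span R
    {u | ∃ l : List (ℕ × L), (∀ q ∈ l, q.2 ∈ ℒ q.1) ∧ (l.map Prod.fst).sum = n ∧
      u = (l.map fun q => ι R q.2).prod}

end UniversalEnvelopingAlgebra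

namespace FreeHopf

/-! ### Sequences -/

/-- `∑_{n ≥ 1} c_n t^n`. -/
noncomputable def genFun (c : ℕ+ → ℕ) : PowerSeries ℚ :=
  PowerSeries.mk fun n => if hn : 0 < n then (c ⟨n, hn⟩ : ℚ) else 0

/-- The relation
`1 + ∑_{k ≥ 1} h_k t^k = 1 / (1 - ∑_{m ≥ 1} a_m t^m) = ∏_{d ≥ 1} 1 / (1 - t^d)^{p_d}`
in `ℚ⟦t⟧`, that is, `a` is the INVERTi transform of `h` and `p` is the inverse Euler transform
of `h`. The factors with `d > N` do not contribute to the coefficient of `t^N` in the infinite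
product, which is therefore the coefficient of `t^N` in the product over `1 ≤ d ≤ N`. -/
def SequenceTriple (h a p : ℕ+ → ℕ) : Prop :=
  1 + genFun h = (1 - genFun a)⁻¹ ∧
  ∀ N : ℕ, PowerSeries.coeff N (1 + genFun h) =
    PowerSeries.coeff N
      (∏ k ∈ Finset.range N, ((1 - PowerSeries.X ^ (k + 1) : PowerSeries ℚ) ^ p k.succPNat)⁻¹)

/-! ### The free Lie algebra and its enveloping algebra -/

/-- The graded alphabet `X_a = ⨄_{n ≥ 1} {x_i^{(n)} | 1 ≤ i ≤ a_n}`; the letter `⟨n, i⟩` has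
degree `n`. -/
abbrev Alphabet (a : ℕ+ → ℕ) : Type := Σ n : ℕ+, Fin (a n)

/-- The degree `n` part of the tensor algebra `T(ℂ X_a)`, spanned by the words of degree `n`. -/
def wordPart (a : ℕ+ → ℕ) (n : ℕ) : Submodule ℂ (FreeAlgebra ℂ (Alphabet a)) :=
  Submodule.span ℂ
    {u | ∃ w : List (Alphabet a), (w.map fun x => (x.1 : ℕ)).sum = n ∧
      u = (w.map (FreeAlgebra.ι ℂ)).prod}

/-- The free Lie algebra `𝔏(a)`: the smallest subspace of `T(ℂ X_a)` that contains `X_a` and is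
closed under the commutator bracket. -/
def freeLie (a : ℕ+ → ℕ) : LieSubalgebra ℂ (FreeAlgebra ℂ (Alphabet a)) :=
  LieSubalgebra.lieSpan ℂ (FreeAlgebra ℂ (Alphabet a)) (Set.range (FreeAlgebra.ι ℂ))

/-- The degree `n` part of the free Lie algebra. -/
def freeLiePart (a : ℕ+ → ℕ) (n : ℕ) : Submodule ℂ (freeLie a) :=
  (wordPart a n).comap (freeLie a).toSubmodule.subtype

/-- The Hopf algebra `U(𝔏(a))`. -/
abbrev UFreeLie (a : ℕ+ → ℕ) : Type := UniversalEnvelopingAlgebra ℂ (freeLie a)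

/-- The degree `n` part of `U(𝔏(a))`. -/
def uFreeLiePart (a : ℕ+ → ℕ) (n : ℕ) : Submodule ℂ (UFreeLie a) :=
  UniversalEnvelopingAlgebra.gradedPart (freeLiePart a) n

/-- The generator `x_i^{(n)}` of `U(𝔏(a))`. -/
noncomputable def gen (a : ℕ+ → ℕ) (n : ℕ+) (i : Fin (a n)) : UFreeLie a :=
  UniversalEnvelopingAlgebra.ι ℂ
    (⟨FreeAlgebra.ι ℂ ⟨n, i⟩, LieSubalgebra.subset_lieSpan ⟨⟨n, i⟩, rfl⟩⟩ : freeLie a)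

/-! ### Free graded connected cocommutative Hopf algebras -/

section Hopf

variable {H : Type*} [Ring H] [HopfAlgebra ℂ H] (𝒜 : ℕ → Submodule ℂ H)

/-- A cocommutative Hopf algebra `H = ⨁ H_n` (`𝒜 n` is `H_n`; the multiplication is graded by the
`GradedAlgebra` instance) with graded comultiplication and counit, which is freely generated as an
algebra by a graded subset `X = ⨄_{n ≥ 1} X^{(n)}`, `X^{(n)} ⊆ H_n`. Freeness implies that
`H_0 = ℂ`, and then the antipode is graded as well. -/
structure IsFGCCHA [GradedAlgebra 𝒜] : Prop where
  comul_mem : ∀ n, ∀ x ∈ 𝒜 n, Coalgebra.comul (R := ℂ) x ∈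
    ⨆ (i : ℕ) (j : ℕ) (_ : i + j = n),
      LinearMap.range (TensorProduct.map (𝒜 i).subtype (𝒜 j).subtype)
  counit_eq_zero : ∀ n, n ≠ 0 → ∀ x ∈ 𝒜 n, Coalgebra.counit (R := ℂ) x = 0
  cocomm : Coalgebra.IsCocomm ℂ H
  free : ∃ X : ℕ+ → Set H, (∀ n, X n ⊆ 𝒜 n) ∧
    Function.Bijective (FreeAlgebra.lift ℂ fun x : Σ n, X n => (x.2 : H))

/-- The graded Hopf algebra isomorphisms `U(𝔏(a)) → H`. An isomorphism of bialgebras between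
Hopf algebras commutes with the antipodes. -/
def gradedIso (a : ℕ+ → ℕ) : Set (UFreeLie a ≃ₐc[ℂ] H) :=
  {φ | ∀ n, ∀ u ∈ uFreeLiePart a n, φ u ∈ 𝒜 n}

variable (H) in
/-- The space `P(H)` of primitive elements. -/
def primitives : Submodule ℂ H where
  carrier := {x | Coalgebra.comul (R := ℂ) x = x ⊗ₜ[ℂ] 1 + 1 ⊗ₜ[ℂ] x}
  add_mem' := fun {x y} hx hy => by
    simp only [Set.mem_ofPred_eq] at *
    rw [map_add, hx, hy, TensorProduct.add_tmul, TensorProduct.tmul_add]; abel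
  zero_mem' := by simp
  smul_mem' := fun c x hx => by
    simp only [Set.mem_ofPred_eq] at *
    rw [map_smul, hx, smul_add, TensorProduct.smul_tmul', TensorProduct.tmul_smul]

/-- The degree `n` part `P(H)_n` of the space of primitive elements. -/
def primPart (n : ℕ) : Submodule ℂ H := primitives H ⊓ 𝒜 n

/-- The degree `n` part `[P(H), P(H)]_n` of the derived subalgebra of the Lie algebra `P(H)`,
spanned by the commutators of homogeneous primitive elements whose degrees add up to `n`. -/
def derivedPart (n : ℕ) : Submodule ℂ H :=
  Submodule.span ℂ
    {z | ∃ i j : ℕ, i + j = n ∧ ∃ x ∈ primPart 𝒜 i, ∃ y ∈ primPart 𝒜 j, z = x * y - y * x}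

/-- Sequences of finite tuples `(α_1^{(n)}, …, α_{ℓ_n}^{(n)})`, `n ≥ 1`, of elements of `H`. -/
abbrev TupleSeq (H : Type*) : Type _ := Σ ℓ : ℕ+ → ℕ, ∀ n : ℕ+, Fin (ℓ n) → H

/-- The set `OPG(H)` of ordered primitive generating sets of `H`: sequences of finite tuples whose
`n`-th tuple consists of elements of `P(H)_n` and whose entries freely generate the algebra `H`. -/
def OPG : Set (TupleSeq H) :=
  {A | (∀ (n : ℕ+) i, A.2 n i ∈ primPart 𝒜 n) ∧
    Function.Bijective (FreeAlgebra.lift ℂ fun x : Σ n, Fin (A.1 n) => A.2 x.1 x.2)}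

/-- The concatenation `(α_1, …, α_a, v_1, …, v_{p-a})` of two tuples. -/
def concat {a p : ℕ} (α : Fin a → H) (v : Fin (p - a) → H) (j : Fin p) : H :=
  if hj : (j : ℕ) < a then α ⟨j, hj⟩
  else v ⟨j - a, Nat.sub_lt_sub_right (Nat.le_of_not_lt hj) j.2⟩

end Hopf

/-- Sequences of `a_n × p_n` complex matrices, `n ≥ 1`, whose leading `a_n × a_n` minors are
nonzero. -/
def LeadingMinorNonzero {a p : ℕ+ → ℕ} (hap : ∀ n, a n ≤ p n) :
    Set (∀ n : ℕ+, Matrix (Fin (a n)) (Fin (p n)) ℂ) :=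
  {M | ∀ n, ((M n).submatrix id (Fin.castLE (hap n))).det ≠ 0}

end FreeHopf

/-!
# Ordered primitive generating sets of free cocommutative Hopf algebras

Let `H` be a graded cocommutative Hopf algebra over `ℂ`, free on homogeneous elements of positive
degrees, with finite-dimensional graded parts.

*Primitive generators.* By cocommutativity, the Adams operation `Ψ(x) = ∑ x₁ x₂` is a morphism of
coalgebras, so the reduced comultiplication intertwines `Ψ` with `Ψ ⊗ Ψ`. By induction on the
degree, `H₊` is spanned by the primitive elements, on which `Ψ` is `2`, and by eigenvectors of `Ψ`
with the eigenvalues `4, 8, …` (`gradedPart_le_primPart_sup_eigenspaces`). As `Ψ` acts as `2` on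
`H₊ / H₊²`, the latter eigenvectors are decomposable. So the generators can be changed by
decomposable elements into primitive ones, and these are free generators again, since the words in
them span and are as numerous as the dimensions require (`bijective_lift_of_span_decPart`).

*The spaces `P(H)_n`.* Let `g` be a family of homogeneous primitive free generators, `D` the
linear map taking a word to its right-normed bracket, and `E` the one multiplying a word by its
length. In the convolution algebra `D * id = E`, hence `D x = E x` for primitive `x`, which makes
`x` a combination of brackets (`primPart_le_letters_sup_derivedPart`). Commutators are
decomposable and free generators are independent modulo decomposable elements, so `P(H)_n` is the
direct sum of the span of the generators of degree `n` and `[P(H), P(H)]_n`.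

*The two product formulas.* The words in free generators are a basis of `H`, which gives the first
formula for the Hilbert series (`one_add_genFun_eq_inv`). The ordered monomials in a homogeneous
basis of `P(H)` are another basis, which gives the Euler product (`coeff_one_add_genFun_finrank`).
They span because a reordering changes a product only by shorter products. They are independent
because they multiply out under `Δ` like divided powers, so that a relation of minimal length
would involve only monomials of length at most one (`linearIndependent_orderedProd`).

*The bijections.* `U(𝔏(a))` is the free algebra on `X_a` (`uFreeLieEquiv`), so its graded Hopf
algebra isomorphisms to `H` are the homogeneous primitive free generating families of shape `a`,
and every ordered primitive generating set has shape `a` by `card_gens_unique`. A primitive family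
generates freely if and only if it is a basis of `H₊` modulo decomposable elements, and this
depends only on the leading square blocks of its coordinate matrices.
-/

namespace FreeHopf

/-! ### Homogeneous families in a graded algebra -/

section Homogeneous

variable {K H ι : Type*} [Field K] [Ring H] [Algebra K H] (𝒜 : ℕ → Submodule K H)
  [GradedAlgebra 𝒜] {deg : ι → ℕ} {v : ι → H}

theorem proj_of_mem_same {n : ℕ} {x : H} (hx : x ∈ 𝒜 n) : GradedAlgebra.proj 𝒜 n x = x := by
  rw [GradedAlgebra.proj_apply, DirectSum.decompose_of_mem_same 𝒜 hx]

theorem proj_of_mem_ne {m n : ℕ} {x : H} (hx : x ∈ 𝒜 m) (hmn : m ≠ n) :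
    GradedAlgebra.proj 𝒜 n x = 0 := by
  rw [GradedAlgebra.proj_apply, DirectSum.decompose_of_mem_ne 𝒜 hx hmn]

theorem mem_span_fiber_of_mem_span (hv : ∀ i, v i ∈ 𝒜 (deg i)) {s : Set ι} {n : ℕ} {x : H}
    (hx : x ∈ 𝒜 n) (hs : x ∈ Submodule.span K (v '' s)) :
    x ∈ Submodule.span K (v '' {i ∈ s | deg i = n}) := by
  have key : ∀ y ∈ Submodule.span K (v '' s),
      GradedAlgebra.proj 𝒜 n y ∈ Submodule.span K (v '' {i ∈ s | deg i = n}) := by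
    intro y hy
    induction hy using Submodule.span_induction with
    | mem y hy =>
      obtain ⟨i, hi, rfl⟩ := hy
      by_cases h : deg i = n
      · rw [proj_of_mem_same 𝒜 (h ▸ hv i)]
        exact Submodule.subset_span ⟨i, ⟨hi, h⟩, rfl⟩
      · rw [proj_of_mem_ne 𝒜 (hv i) h]
        exact Submodule.zero_mem _
    | zero => simp
    | add y z _ _ hy hz => rw [map_add]; exact Submodule.add_mem _ hy hz
    | smul c y _ hy => rw [map_smul]; exact Submodule.smul_mem _ c hy
  rw [← proj_of_mem_same 𝒜 hx]
  exact key x hs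

theorem span_fiber_eq (hv : ∀ i, v i ∈ 𝒜 (deg i)) (hs : Submodule.span K (Set.range v) = ⊤)
    (n : ℕ) : Submodule.span K (Set.range fun i : {i // deg i = n} => v i) = 𝒜 n := by
  apply le_antisymm
  · rw [Submodule.span_le]
    rintro _ ⟨⟨i, rfl⟩, rfl⟩
    exact hv i
  · intro x hx
    have := mem_span_fiber_of_mem_span 𝒜 hv (s := Set.univ) hx (by
      rw [Set.image_univ, hs]; trivial)
    refine Submodule.span_mono ?_ this
    rintro _ ⟨i, ⟨-, hi⟩, rfl⟩
    exact ⟨⟨i, hi⟩, rfl⟩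

/-- The part of degree `n` of a homogeneous basis, as a basis of the degree `n` part. -/
noncomputable def fiberBasis (hv : ∀ i, v i ∈ 𝒜 (deg i)) (hli : LinearIndependent K v)
    (hs : Submodule.span K (Set.range v) = ⊤) (n : ℕ) :
    Module.Basis {i // deg i = n} K (𝒜 n) :=
  (Module.Basis.span (hli.comp (fun i : {i // deg i = n} => (i : ι))
    Subtype.val_injective)).map (LinearEquiv.ofEq _ _ (span_fiber_eq 𝒜 hv hs n))

theorem finite_fiber (hv : ∀ i, v i ∈ 𝒜 (deg i)) (hli : LinearIndependent K v)
    (hs : Submodule.span K (Set.range v) = ⊤) (n : ℕ) [Module.Finite K (𝒜 n)] :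
    Finite {i // deg i = n} :=
  Module.Finite.finite_basis (fiberBasis 𝒜 hv hli hs n)

theorem finrank_eq_card_fiber (hv : ∀ i, v i ∈ 𝒜 (deg i)) (hli : LinearIndependent K v)
    (hs : Submodule.span K (Set.range v) = ⊤) (n : ℕ) :
    Module.finrank K (𝒜 n) = Nat.card {i // deg i = n} :=
  Module.finrank_eq_nat_card_basis (fiberBasis 𝒜 hv hli hs n)

/-- A homogeneous family is linearly independent if its members of each degree are. -/
theorem linearIndependent_of_fiber (hv : ∀ i, v i ∈ 𝒜 (deg i))
    (hfib : ∀ n, LinearIndependent K fun i : {i // deg i = n} => v i) :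
    LinearIndependent K v := by
  classical
  rw [linearIndependent_iff]
  intro c hc0
  ext i
  have h1 : GradedAlgebra.proj 𝒜 (deg i) (Finsupp.linearCombination K v c) =
      Finsupp.linearCombination K v (c.filter fun j => deg j = deg i) := by
    rw [Finsupp.linearCombination_apply, Finsupp.linearCombination_apply, map_finsuppSum,
      Finsupp.sum, Finsupp.sum, Finsupp.support_filter, Finset.sum_filter]
    refine Finset.sum_congr rfl fun j _ => ?_
    rw [map_smul]
    split_ifs with h
    · rw [proj_of_mem_same 𝒜 (h ▸ hv j), Finsupp.filter_apply_pos (fun j => deg j = deg i) c h]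
    · rw [proj_of_mem_ne 𝒜 (hv j) h, smul_zero]
  rw [hc0, map_zero] at h1
  have h2 := (linearIndepOn_iff (s := {j | deg j = deg i}) (v := v) (R := K)).1 (hfib (deg i))
    (c.filter fun j => deg j = deg i) (by
      rw [Finsupp.mem_supported]
      intro j hj
      by_contra h
      exact (Finsupp.mem_support_iff.1 hj)
        (Finsupp.filter_apply_neg (fun j => deg j = deg i) c h)) h1.symm
  have h3 := DFunLike.congr_fun h2 i
  rwa [Finsupp.filter_apply_pos (fun j => deg j = deg i) c rfl] at h3

/-- A homogeneous spanning family which has the right number of members in each degree is linearly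
independent. -/
theorem linearIndependent_of_card_fiber (hv : ∀ i, v i ∈ 𝒜 (deg i))
    (hs : Submodule.span K (Set.range v) = ⊤) (hf : ∀ n, Finite {i // deg i = n})
    (hc : ∀ n, Nat.card {i // deg i = n} = Module.finrank K (𝒜 n)) :
    LinearIndependent K v := by
  refine linearIndependent_of_fiber 𝒜 hv fun n => ?_
  have := hf n
  have := Fintype.ofFinite {i // deg i = n}
  rw [linearIndependent_iff_card_eq_finrank_span, ← Nat.card_eq_fintype_card, hc n,
    Set.finrank, span_fiber_eq 𝒜 hv hs n]

end Homogeneous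

/-! ### Words -/

section Words

variable {K H X : Type*} [Field K] [Ring H] [Algebra K H]

/-- The product of the letters of a word. -/
def wordProd (g : X → H) (w : List X) : H := (w.map g).prod

@[simp] theorem wordProd_nil (g : X → H) : wordProd g [] = 1 := rfl

@[simp] theorem wordProd_cons (g : X → H) (x : X) (w : List X) :
    wordProd g (x :: w) = g x * wordProd g w := by simp [wordProd]

theorem wordProd_append (g : X → H) (w w' : List X) :
    wordProd g (w ++ w') = wordProd g w * wordProd g w' := by simp [wordProd]

/-- The degree of a word. -/
def wordDeg (deg : X → ℕ) (w : List X) : ℕ := (w.map deg).sum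

@[simp] theorem wordDeg_nil (deg : X → ℕ) : wordDeg deg [] = 0 := rfl

@[simp] theorem wordDeg_cons (deg : X → ℕ) (x : X) (w : List X) :
    wordDeg deg (x :: w) = deg x + wordDeg deg w := by simp [wordDeg]

theorem wordProd_mem (𝒜 : ℕ → Submodule K H) [GradedAlgebra 𝒜] {deg : X → ℕ} {g : X → H}
    (hg : ∀ x, g x ∈ 𝒜 (deg x)) (w : List X) : wordProd g w ∈ 𝒜 (wordDeg deg w) := by
  induction w with
  | nil => exact SetLike.GradedOne.one_mem
  | cons x w ih =>
    rw [wordProd_cons, wordDeg_cons]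
    exact SetLike.GradedMul.mul_mem (hg x) ih

variable (K X) in
/-- The basis of the free algebra formed by the words. -/
noncomputable def wordBasis : Module.Basis (List X) K (FreeAlgebra K X) :=
  (FreeAlgebra.basisFreeMonoid K X).reindex FreeMonoid.toList

theorem wordBasis_apply (w : List X) : wordBasis K X w = wordProd (FreeAlgebra.ι K) w := by
  have h : ∀ w : List X, FreeAlgebra.equivMonoidAlgebraFreeMonoid (wordProd (FreeAlgebra.ι K) w) =
      MonoidAlgebra.single (FreeMonoid.ofList w) (1 : K) := by
    intro w
    induction w with
    | nil => simp [MonoidAlgebra.one_def]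
    | cons x w ih =>
      rw [wordProd_cons, map_mul, ih, FreeMonoid.ofList_cons]
      simp [FreeAlgebra.equivMonoidAlgebraFreeMonoid, MonoidAlgebra.single_mul_single]
  simp only [wordBasis, FreeAlgebra.basisFreeMonoid, Module.Basis.reindex_apply,
    Module.Basis.map_apply]
  rw [LinearEquiv.symm_apply_eq, LinearEquiv.trans_apply, AlgEquiv.toLinearEquiv_apply, h,
    Finsupp.coe_basisSingleOne]
  rfl

theorem lift_wordProd_ι (g : X → H) (w : List X) :
    FreeAlgebra.lift K g (wordProd (FreeAlgebra.ι K) w) = wordProd g w := by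
  rw [wordProd, wordProd, map_list_prod, List.map_map]
  congr 2
  ext x
  simp

/-- Freeness in terms of words. -/
theorem bijective_lift_iff (g : X → H) :
    Function.Bijective (FreeAlgebra.lift K g) ↔
      LinearIndependent K (wordProd g) ∧ Submodule.span K (Set.range (wordProd g)) = ⊤ := by
  set b := wordBasis K X with hb
  set L := (FreeAlgebra.lift K g).toLinearMap with hLdef
  have hL : wordProd g = L ∘ b := by
    ext w
    rw [Function.comp_apply, hb, wordBasis_apply]
    exact (lift_wordProd_ι g w).symm
  have hcomb : Finsupp.linearCombination K (wordProd g) = L ∘ₗ b.repr.symm.toLinearMap := by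
    rw [hL]
    ext w
    simp
  have h1 : LinearIndependent K (wordProd g) ↔ Function.Injective L := by
    rw [LinearIndependent, hcomb]
    exact EquivLike.injective_comp b.repr.symm L
  have h2 : Submodule.span K (Set.range (wordProd g)) = ⊤ ↔ Function.Surjective L := by
    rw [← Finsupp.range_linearCombination, hcomb, LinearMap.range_eq_top]
    exact EquivLike.surjective_comp b.repr.symm L
  rw [h1, h2]
  rfl

end Words

/-! ### Homogeneous free generators and decomposable elements -/

section Decomposable

variable {K H X : Type*} [Field K] [Ring H] [Algebra K H] (𝒜 : ℕ → Submodule K H)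

/-- The decomposable elements of degree `n`: the sums of products of two homogeneous elements of
positive degrees that add up to `n`. -/
def decPart (n : ℕ) : Submodule K H :=
  Submodule.span K
    {z | ∃ i j : ℕ, 0 < i ∧ 0 < j ∧ i + j = n ∧ ∃ x ∈ 𝒜 i, ∃ y ∈ 𝒜 j, z = x * y}

variable [GradedAlgebra 𝒜] {deg : X → ℕ} {g : X → H}

theorem decPart_le (n : ℕ) : decPart 𝒜 n ≤ 𝒜 n := by
  rw [decPart, Submodule.span_le]
  rintro _ ⟨i, j, -, -, rfl, x, hx, y, hy, rfl⟩
  exact SetLike.GradedMul.mul_mem hx hy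

theorem mul_mem_span_words {w₁ w₂ w₃ : Set (List X)}
    (h : ∀ u ∈ w₁, ∀ v ∈ w₂, u ++ v ∈ w₃) {x y : H}
    (hx : x ∈ Submodule.span K (wordProd g '' w₁))
    (hy : y ∈ Submodule.span K (wordProd g '' w₂)) :
    x * y ∈ Submodule.span K (wordProd g '' w₃) := by
  have := Submodule.mul_mem_mul hx hy
  rw [Submodule.span_mul_span] at this
  refine Submodule.span_mono ?_ this
  rintro _ ⟨_, ⟨u, hu, rfl⟩, _, ⟨v, hv, rfl⟩, rfl⟩
  exact ⟨u ++ v, h u hu v hv, wordProd_append g u v⟩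

variable (hdeg : ∀ x, 0 < deg x) (hg : ∀ x, g x ∈ 𝒜 (deg x))

include hdeg in
theorem wordDeg_pos {w : List X} (hw : w ≠ []) : 0 < wordDeg deg w := by
  cases w with
  | nil => exact absurd rfl hw
  | cons x w =>
    rw [wordDeg_cons]
    exact Nat.add_pos_left (hdeg x) _

include hdeg hg in
/-- A graded algebra generated in positive degrees is connected. -/
theorem gradedPart_zero_le (hs : Submodule.span K (Set.range (wordProd g)) = ⊤) :
    𝒜 0 ≤ Submodule.span K {1} := by
  rw [← span_fiber_eq 𝒜 (wordProd_mem 𝒜 hg) hs 0, Submodule.span_le]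
  rintro _ ⟨⟨w, hw⟩, rfl⟩
  by_cases h : w = []
  · subst h
    exact Submodule.subset_span rfl
  · exact absurd hw (wordDeg_pos hdeg h).ne'

include hg in
theorem gradedPart_le_span_ne_nil (hs : Submodule.span K (Set.range (wordProd g)) = ⊤) {n : ℕ}
    (hn : 0 < n) : 𝒜 n ≤ Submodule.span K (wordProd g '' {w | w ≠ []}) := by
  rw [← span_fiber_eq 𝒜 (wordProd_mem 𝒜 hg) hs n, Submodule.span_le]
  rintro _ ⟨⟨w, hw⟩, rfl⟩
  refine Submodule.subset_span ⟨w, ?_, rfl⟩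
  rintro rfl
  exact hn.ne' hw.symm

include hg in
theorem decPart_le_span_two_le_length (hs : Submodule.span K (Set.range (wordProd g)) = ⊤)
    (n : ℕ) : decPart 𝒜 n ≤ Submodule.span K (wordProd g '' {w | 2 ≤ w.length}) := by
  rw [decPart, Submodule.span_le]
  rintro _ ⟨i, j, hi, hj, -, x, hx, y, hy, rfl⟩
  refine mul_mem_span_words (fun u hu v hv => ?_) (gradedPart_le_span_ne_nil 𝒜 hg hs hi hx)
    (gradedPart_le_span_ne_nil 𝒜 hg hs hj hy)
  have h1 := List.length_pos_iff.2 hu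
  have h2 := List.length_pos_iff.2 hv
  simp only [Set.mem_ofPred_eq, List.length_append]
  omega

include hg in
/-- Free generators are linearly independent modulo the decomposable elements. -/
theorem disjoint_span_decPart (hli : LinearIndependent K (wordProd g))
    (hs : Submodule.span K (Set.range (wordProd g)) = ⊤) (n : ℕ) :
    Disjoint (Submodule.span K (Set.range g)) (decPart 𝒜 n) := by
  have hd : Disjoint {w : List X | w.length = 1} {w | 2 ≤ w.length} :=
    Set.disjoint_left.2 fun w h1 h2 => by
      simp only [Set.mem_ofPred_eq] at h1 h2
      omega
  refine (hli.disjoint_span_image hd).mono (Submodule.span_mono ?_)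
    (decPart_le_span_two_le_length 𝒜 hg hs n)
  rintro _ ⟨x, rfl⟩
  exact ⟨[x], rfl, by simp⟩

theorem linearIndependent_letters (hli : LinearIndependent K (wordProd g)) :
    LinearIndependent K g := by
  have := hli.comp (fun x : X => [x]) (fun x y h => by simpa using h)
  convert this using 1
  ext x
  simp

include hdeg hg in
/-- Modulo the decomposable elements, the generators of degree `n` span the degree `n` part. -/
theorem gradedPart_le_letters_sup_decPart (hs : Submodule.span K (Set.range (wordProd g)) = ⊤)
    {n : ℕ} (hn : 0 < n) : 𝒜 n ≤ Submodule.span K (g '' {x | deg x = n}) ⊔ decPart 𝒜 n := by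
  conv_lhs => rw [← span_fiber_eq 𝒜 (wordProd_mem 𝒜 hg) hs n]
  rw [Submodule.span_le]
  rintro _ ⟨⟨w, hw⟩, rfl⟩
  match w, hw with
  | [], hw => exact absurd hw hn.ne
  | [x], hw =>
    refine Submodule.mem_sup_left (Submodule.subset_span ⟨x, by simpa using hw, by simp⟩)
  | x :: y :: w, hw =>
    refine Submodule.mem_sup_right (Submodule.subset_span
      ⟨deg x, wordDeg deg (y :: w), hdeg x, wordDeg_pos hdeg (by simp), by simpa using hw,
        g x, hg x, _, wordProd_mem 𝒜 hg _, by simp⟩)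

/-- Homogeneous elements which span each graded part of positive degree modulo the decomposable
elements generate a connected graded algebra. -/
theorem span_words_eq_top (h0 : 𝒜 0 ≤ Submodule.span K {1})
    (h : ∀ n, 0 < n → 𝒜 n ≤ Submodule.span K (g '' {x | deg x = n}) ⊔ decPart 𝒜 n) :
    Submodule.span K (Set.range (wordProd g)) = ⊤ := by
  set W := Submodule.span K (Set.range (wordProd g)) with hW
  have hle : ∀ n, 𝒜 n ≤ W := by
    intro n
    induction n using Nat.strong_induction_on with
    | _ n ih =>
      rcases Nat.eq_zero_or_pos n with rfl | hn
      · refine h0.trans (Submodule.span_mono ?_)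
        rintro _ rfl
        exact ⟨[], rfl⟩
      · refine (h n hn).trans (sup_le (Submodule.span_mono ?_) ?_)
        · rintro _ ⟨x, -, rfl⟩
          exact ⟨[x], by simp⟩
        · rw [decPart, Submodule.span_le]
          rintro _ ⟨i, j, hi, hj, rfl, x, hx, y, hy, rfl⟩
          have hx' := ih i (by omega) hx
          have hy' := ih j (by omega) hy
          rw [hW, ← Set.image_univ] at hx' hy' ⊢
          exact mul_mem_span_words (fun u _ v _ => Set.mem_univ (u ++ v)) hx' hy'
  rw [eq_top_iff, ← DirectSum.IsInternal.submodule_iSup_eq_top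
    (DirectSum.Decomposition.isInternal 𝒜)]
  exact iSup_le hle

end Decomposable

/-! ### Counting words -/

section Count

variable {X : Type*} {deg : X → ℕ}

/-- Splitting off the first letter of a nonempty word. -/
def wordSplit (deg : X → ℕ) {n : ℕ} (hn : n ≠ 0) :
    {w : List X // wordDeg deg w = n} ≃
      Σ p : Finset.HasAntidiagonal.antidiagonal n,
        {x // deg x = p.1.1} × {w : List X // wordDeg deg w = p.1.2} where
  toFun := fun
    | ⟨[], h⟩ => absurd h.symm hn
    | ⟨x :: w, h⟩ => ⟨⟨(deg x, wordDeg deg w), by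
        rw [Finset.HasAntidiagonal.mem_antidiagonal, ← h, wordDeg_cons]⟩, ⟨x, rfl⟩, ⟨w, rfl⟩⟩
  invFun := fun q => ⟨q.2.1.1 :: q.2.2.1, by
    rw [wordDeg_cons, q.2.1.2, q.2.2.2]
    exact Finset.HasAntidiagonal.mem_antidiagonal.1 q.1.2⟩
  left_inv := fun
    | ⟨[], h⟩ => absurd h.symm hn
    | ⟨x :: w, h⟩ => rfl
  right_inv := by
    rintro ⟨⟨⟨i, j⟩, hp⟩, ⟨x, hx⟩, ⟨w, hw⟩⟩
    simp only at hx hw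
    subst hx hw
    rfl

theorem card_words (hX : ∀ n, Finite {x // deg x = n})
    (hW : ∀ n, Finite {w : List X // wordDeg deg w = n}) {n : ℕ} (hn : n ≠ 0) :
    Nat.card {w : List X // wordDeg deg w = n} = ∑ p ∈ Finset.HasAntidiagonal.antidiagonal n,
      Nat.card {x // deg x = p.1} * Nat.card {w : List X // wordDeg deg w = p.2} := by
  rw [Nat.card_congr (wordSplit deg hn), Nat.card_sigma]
  simp only [Nat.card_prod]
  exact Finset.sum_coe_sort (Finset.HasAntidiagonal.antidiagonal n) fun p =>
    Nat.card {x // deg x = p.1} * Nat.card {w : List X // wordDeg deg w = p.2}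

/-- The degree of a letter. -/
abbrev letterDeg (a : ℕ+ → ℕ) (x : Alphabet a) : ℕ := x.1

theorem letterDeg_pos {a : ℕ+ → ℕ} (x : Alphabet a) : 0 < letterDeg a x := x.1.pos

/-- The letters of degree `n` are the elements of `Fin (a n)`. -/
def letterEquiv (a : ℕ+ → ℕ) (n : ℕ+) : {x // letterDeg a x = n} ≃ Fin (a n) where
  toFun := fun x => Fin.cast (congrArg a (PNat.coe_injective x.2)) x.1.2
  invFun := fun i => ⟨⟨n, i⟩, rfl⟩
  left_inv := by
    rintro ⟨⟨m, i⟩, h⟩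
    obtain rfl : m = n := PNat.coe_injective h
    rfl
  right_inv := fun i => rfl

theorem card_letters (a : ℕ+ → ℕ) (n : ℕ) :
    Nat.card {x // letterDeg a x = n} = if hn : 0 < n then a ⟨n, hn⟩ else 0 := by
  split_ifs with hn
  · exact (Nat.card_congr (letterEquiv a ⟨n, hn⟩)).trans (Nat.card_fin _)
  · rw [Nat.card_eq_zero]
    exact Or.inl ⟨fun x => hn (x.2 ▸ letterDeg_pos x.1)⟩

instance finite_letters (a : ℕ+ → ℕ) (n : ℕ) : Finite {x // letterDeg a x = n} := by
  by_cases hn : 0 < n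
  · exact Finite.of_equiv _ (letterEquiv a ⟨n, hn⟩).symm
  · have : IsEmpty {x // letterDeg a x = n} := ⟨fun x => hn (x.2 ▸ letterDeg_pos x.1)⟩
    infer_instance

theorem card_words_zero (a : ℕ+ → ℕ) :
    Nat.card {w // wordDeg (letterDeg a) w = 0} = 1 := by
  rw [Nat.card_eq_one_iff_unique]
  refine ⟨⟨fun u v => ?_⟩, ⟨⟨[], rfl⟩⟩⟩
  have key : ∀ u : {w // wordDeg (letterDeg a) w = 0}, u.1 = [] := by
    rintro ⟨u, hu⟩
    by_contra h
    exact (wordDeg_pos letterDeg_pos h).ne' hu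
  exact Subtype.ext ((key u).trans (key v).symm)

theorem coeff_genFun (c : ℕ+ → ℕ) (n : ℕ) :
    PowerSeries.coeff n (genFun c) = (Nat.card {x // letterDeg c x = n} : ℚ) := by
  rw [genFun, PowerSeries.coeff_mk, card_letters]
  split_ifs <;> simp

theorem constantCoeff_genFun (c : ℕ+ → ℕ) : PowerSeries.constantCoeff (genFun c) = 0 := by
  rw [← PowerSeries.coeff_zero_eq_constantCoeff_apply, genFun, PowerSeries.coeff_mk]
  simp

theorem genFun_injective : Function.Injective genFun := by
  intro c d h
  ext n
  have := congrArg (PowerSeries.coeff (n : ℕ)) h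
  simp only [genFun, PowerSeries.coeff_mk, dif_pos n.pos, Nat.cast_inj] at this
  exact this

/-- The generating function of the words is the INVERT transform of that of the letters. -/
theorem one_add_genFun_eq_inv (h a : ℕ+ → ℕ)
    (hW : ∀ n, Finite {w // wordDeg (letterDeg a) w = n})
    (hh : ∀ n : ℕ+, h n = Nat.card {w // wordDeg (letterDeg a) w = n}) :
    1 + genFun h = (1 - genFun a)⁻¹ := by
  rw [PowerSeries.eq_inv_iff_mul_eq_one (by simp [constantCoeff_genFun])]
  have hc : ∀ n, PowerSeries.coeff n (1 + genFun h) =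
      (Nat.card {w // wordDeg (letterDeg a) w = n} : ℚ) := by
    intro n
    rcases Nat.eq_zero_or_pos n with rfl | hn
    · rw [card_words_zero]
      simp [constantCoeff_genFun]
    · rw [map_add, PowerSeries.coeff_one, if_neg hn.ne', zero_add, genFun, PowerSeries.coeff_mk,
        dif_pos hn, hh ⟨n, hn⟩]
      rfl
  have hmul : (1 + genFun h) * genFun a = genFun h := by
    ext n
    rcases Nat.eq_zero_or_pos n with rfl | hn
    · simp [constantCoeff_genFun]
    · rw [mul_comm, PowerSeries.coeff_mul]
      have h1 := hc n
      rw [map_add, PowerSeries.coeff_one, if_neg hn.ne', zero_add] at h1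
      rw [h1, card_words (finite_letters a) hW hn.ne', Nat.cast_sum]
      refine Finset.sum_congr rfl fun p _ => ?_
      rw [hc, coeff_genFun, Nat.cast_mul]
  rw [mul_sub, hmul, mul_one, add_sub_cancel_right]

end Count

/-! ### Homogeneous free generating families of a graded algebra -/

section FreeGen

variable {H : Type*} [Ring H] [Algebra ℂ H] (𝒜 : ℕ → Submodule ℂ H) [GradedAlgebra 𝒜]

theorem bijective_lift_comp_equiv {X Y : Type*} (e : Y ≃ X) {g : X → H}
    (hg : Function.Bijective (FreeAlgebra.lift ℂ g)) :
    Function.Bijective (FreeAlgebra.lift ℂ (g ∘ e)) := by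
  rw [bijective_lift_iff] at hg ⊢
  have : wordProd (g ∘ e) = wordProd g ∘ List.map e := by
    ext w
    simp [wordProd]
  have hb : Function.Bijective (List.map e) := (Equiv.listEquivOfEquiv e).bijective
  rw [this]
  exact ⟨hg.1.comp _ hb.1, by rw [hb.2.range_comp]; exact hg.2⟩

/-- A homogeneous free generating set of an algebra with finite-dimensional graded parts is finite
in each degree, so it can be enumerated. -/
theorem exists_alphabet (hfin : ∀ n, Module.Finite ℂ (𝒜 n))
    {X : ℕ+ → Set H} (hX : ∀ n, X n ⊆ 𝒜 n)
    (hfree : Function.Bijective (FreeAlgebra.lift ℂ fun x : Σ n, X n => (x.2 : H))) :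
    ∃ (a : ℕ+ → ℕ) (g : Alphabet a → H), (∀ x, g x ∈ 𝒜 (letterDeg a x)) ∧
      Function.Bijective (FreeAlgebra.lift ℂ g) := by
  set g : (Σ n, X n) → H := fun x => (x.2 : H) with hgdef
  have hg : ∀ x : Σ n, X n, g x ∈ 𝒜 (x.1 : ℕ) := fun x => hX x.1 x.2.2
  obtain ⟨hli, hs⟩ := (bijective_lift_iff (K := ℂ) g).1 hfree
  have hXfin : ∀ n, Finite (X n) := by
    intro n
    have := finite_fiber 𝒜 (wordProd_mem 𝒜 hg) hli hs n
    refine Finite.of_injective (β := {w // wordDeg (fun x : Σ n, X n => (x.1 : ℕ)) w = n})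
      (fun x => ⟨[⟨n, x⟩], by simp⟩) fun x y h => ?_
    simpa using h
  let e : ∀ n, Fin (Nat.card (X n)) ≃ X n := fun n => (Finite.equivFin (X n)).symm
  exact ⟨fun n => Nat.card (X n), g ∘ Equiv.sigmaCongrRight e,
    fun x => hg (Equiv.sigmaCongrRight e x),
    bijective_lift_comp_equiv _ hfree⟩

variable {𝒜} {a : ℕ+ → ℕ} {g : Alphabet a → H}

theorem one_add_genFun_finrank (hfin : ∀ n, Module.Finite ℂ (𝒜 n))
    (hg : ∀ x, g x ∈ 𝒜 (letterDeg a x)) (hfree : Function.Bijective (FreeAlgebra.lift ℂ g)) :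
    1 + genFun (fun n => Module.finrank ℂ (𝒜 n)) = (1 - genFun a)⁻¹ := by
  obtain ⟨hli, hs⟩ := (bijective_lift_iff (K := ℂ) g).1 hfree
  exact one_add_genFun_eq_inv _ a (fun n => finite_fiber 𝒜 (wordProd_mem 𝒜 hg) hli hs n)
    fun n => finrank_eq_card_fiber 𝒜 (wordProd_mem 𝒜 hg) hli hs n

/-- The numbers of free generators in each degree are determined by the Hilbert series. -/
theorem card_gens_unique (hfin : ∀ n, Module.Finite ℂ (𝒜 n))
    (hg : ∀ x, g x ∈ 𝒜 (letterDeg a x)) (hfree : Function.Bijective (FreeAlgebra.lift ℂ g))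
    {b : ℕ+ → ℕ} {f : Alphabet b → H}
    (hf : ∀ x, f x ∈ 𝒜 (letterDeg b x)) (hfreef : Function.Bijective (FreeAlgebra.lift ℂ f)) :
    b = a := by
  have h := (one_add_genFun_finrank hfin hf hfreef).symm.trans
    (one_add_genFun_finrank hfin hg hfree)
  have h0 : ∀ c : ℕ+ → ℕ, PowerSeries.constantCoeff (1 - genFun c) ≠ 0 := fun c => by
    simp [constantCoeff_genFun]
  apply genFun_injective
  have h1 := PowerSeries.mul_inv_cancel _ (h0 a)
  have h2 := PowerSeries.inv_mul_cancel _ (h0 b)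
  rw [h] at h2
  have h3 := left_inv_eq_right_inv h1 h2
  exact (sub_right_injective (b := (1 : PowerSeries ℚ)) h3).symm

/-- In a graded algebra that is free on homogeneous elements of positive degrees, a homogeneous
family of the same shape which generates modulo decomposable elements generates freely. -/
theorem bijective_lift_of_span_decPart (hfin : ∀ n, Module.Finite ℂ (𝒜 n))
    (hg : ∀ x, g x ∈ 𝒜 (letterDeg a x)) (hfree : Function.Bijective (FreeAlgebra.lift ℂ g))
    {f : Alphabet a → H} (hf : ∀ x, f x ∈ 𝒜 (letterDeg a x))
    (h : ∀ x, g x ∈ Submodule.span ℂ (f '' {y | letterDeg a y = letterDeg a x}) ⊔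
      decPart 𝒜 (letterDeg a x)) :
    Function.Bijective (FreeAlgebra.lift ℂ f) := by
  obtain ⟨hli, hs⟩ := (bijective_lift_iff (K := ℂ) g).1 hfree
  rw [bijective_lift_iff]
  have hsf : Submodule.span ℂ (Set.range (wordProd f)) = ⊤ := by
    refine span_words_eq_top 𝒜 (deg := letterDeg a)
      (gradedPart_zero_le 𝒜 letterDeg_pos hg hs) fun n hn => ?_
    refine (gradedPart_le_letters_sup_decPart 𝒜 letterDeg_pos hg hs hn).trans
      (sup_le (Submodule.span_le.2 ?_) le_sup_right)
    rintro _ ⟨x, rfl, rfl⟩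
    exact h x
  refine ⟨linearIndependent_of_card_fiber 𝒜 (wordProd_mem 𝒜 hf) hsf
    (fun n => finite_fiber 𝒜 (wordProd_mem 𝒜 hg) hli hs n)
    (fun n => (finrank_eq_card_fiber 𝒜 (wordProd_mem 𝒜 hg) hli hs n).symm), hsf⟩

end FreeGen

/-! ### Eigenvectors and intertwining maps -/

/-- Let `δ` intertwine `f` and `T`, let `W` be stable under `f`, and let `f` act on `W ∩ ker δ` as
the scalar `c`. An element of `W` whose image under `δ` is a sum of eigenvectors with eigenvalues
`μ k ≠ c` is itself the sum of an element of `ker δ` and of eigenvectors with these eigenvalues. -/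
theorem mem_ker_sup_eigenspaces {K V V' κ : Type*} [Field K] [AddCommGroup V] [Module K V]
    [AddCommGroup V'] [Module K V'] {f : Module.End K V} {T : Module.End K V'} {δ : V →ₗ[K] V'}
    (hδ : ∀ x, δ (f x) = T (δ x)) {W : Submodule K V} (hW : ∀ x ∈ W, f x ∈ W) {c : K}
    (hker : ∀ x ∈ W, δ x = 0 → f x = c • x) {μ : κ → K} (hμ : Function.Injective μ)
    (hc : ∀ k, μ k ≠ c) (s : Finset κ) :
    ∀ x ∈ W, δ x ∈ ⨆ k ∈ s, T.eigenspace (μ k) →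
      x ∈ (W ⊓ LinearMap.ker δ) ⊔ ⨆ k ∈ s, (f.eigenspace (μ k) ⊓ W) := by
  classical
  induction s using Finset.induction_on with
  | empty =>
    intro x hx h
    simp only [Finset.notMem_empty, iSup_false, iSup_bot, Submodule.mem_bot] at h
    exact Submodule.mem_sup_left ⟨hx, h⟩
  | insert k s hk ih =>
    intro x hx h
    set U := (W ⊓ LinearMap.ker δ) ⊔ ⨆ j ∈ s, (f.eigenspace (μ j) ⊓ W) with hU
    -- `f - μ k` maps `x` into the span `U` of the previous eigenvectors
    have h1 : f x - μ k • x ∈ U := by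
      refine ih _ (W.sub_mem (hW x hx) (W.smul_mem _ hx)) ?_
      rw [map_sub, map_smul, hδ]
      rw [Finset.iSup_insert] at h
      obtain ⟨y, hy, z, hz, hyz⟩ := Submodule.mem_sup.1 h
      rw [← hyz, map_add, Module.End.mem_eigenspace_iff.1 hy, smul_add, add_sub_add_left_eq_sub]
      have key : ∀ z ∈ ⨆ j ∈ s, T.eigenspace (μ j), T z ∈ ⨆ j ∈ s, T.eigenspace (μ j) := by
        intro z hz
        have : (⨆ j ∈ s, T.eigenspace (μ j)) ≤ (⨆ j ∈ s, T.eigenspace (μ j)).comap T := by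
          refine iSup₂_le fun j hj w hw => ?_
          rw [Submodule.mem_comap, Module.End.mem_eigenspace_iff.1 hw]
          exact Submodule.smul_mem _ _ (Submodule.mem_iSup_of_mem j
            (Submodule.mem_iSup_of_mem hj hw))
        exact this hz
      exact Submodule.sub_mem _ (key z hz) (Submodule.smul_mem _ _ hz)
    -- and `f - μ k` is invertible on `U`
    have h2 : ∀ u ∈ U, ∃ u' ∈ U, f u' - μ k • u' = u ∧ u' ∈ W := by
      have hle : U ≤ (U ⊓ W).map (f - μ k • LinearMap.id) := by
        refine sup_le (fun u hu => ?_) (iSup₂_le fun j hj u hu => ?_)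
        · refine ⟨(c - μ k)⁻¹ • u, ⟨U.smul_mem _ (Submodule.mem_sup_left hu),
            W.smul_mem _ hu.1⟩, ?_⟩
          rw [LinearMap.sub_apply, LinearMap.smul_apply, LinearMap.id_apply, map_smul,
            hker u hu.1 hu.2, smul_comm (μ k), ← smul_sub, ← sub_smul, smul_smul,
            inv_mul_cancel₀ (sub_ne_zero.2 (hc k).symm), one_smul]
        · have hjk : μ j - μ k ≠ 0 := sub_ne_zero.2 fun h => hk (hμ h ▸ hj)
          refine ⟨(μ j - μ k)⁻¹ • u, ⟨U.smul_mem _ (Submodule.mem_sup_right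
            (Submodule.mem_iSup_of_mem j (Submodule.mem_iSup_of_mem hj hu))),
            W.smul_mem _ hu.2⟩, ?_⟩
          rw [LinearMap.sub_apply, LinearMap.smul_apply, LinearMap.id_apply, map_smul,
            Module.End.mem_eigenspace_iff.1 hu.1, smul_comm (μ k), ← smul_sub,
            ← sub_smul, smul_smul, inv_mul_cancel₀ hjk, one_smul]
      intro u hu
      obtain ⟨u', hu', rfl⟩ := hle hu
      exact ⟨u', hu'.1, rfl, hu'.2⟩
    obtain ⟨u, hu, hux, huW⟩ := h2 _ h1
    have h3 : x - u ∈ f.eigenspace (μ k) ⊓ W := by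
      refine ⟨Module.End.mem_eigenspace_iff.2 ?_, W.sub_mem hx huW⟩
      have := sub_eq_sub_iff_sub_eq_sub.1 hux
      rw [map_sub, smul_sub, ← neg_sub (f u), this, neg_sub]
    rw [Finset.iSup_insert, ← sub_add_cancel x u, sup_left_comm]
    exact Submodule.add_mem_sup h3 hu

/-! ### Primitive elements and indecomposables -/

section Primitive

variable {H : Type*} [Ring H] [Bialgebra ℂ H]

variable (H) in
/-- The reduced comultiplication `x ↦ Δ(x) - x ⊗ 1 - 1 ⊗ x`. -/
noncomputable def redComul : H →ₗ[ℂ] H ⊗[ℂ] H :=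
  Coalgebra.comul - (TensorProduct.mk ℂ H H).flip 1 - TensorProduct.mk ℂ H H 1

theorem redComul_apply (x : H) :
    redComul H x = Coalgebra.comul (R := ℂ) x - x ⊗ₜ[ℂ] 1 - 1 ⊗ₜ[ℂ] x := rfl

theorem comul_eq_redComul_add (x : H) :
    Coalgebra.comul (R := ℂ) x = redComul H x + x ⊗ₜ[ℂ] 1 + 1 ⊗ₜ[ℂ] x := by
  rw [redComul_apply]; abel

theorem counit_of_comul {x : H} (hx : Coalgebra.comul (R := ℂ) x = x ⊗ₜ[ℂ] 1 + 1 ⊗ₜ[ℂ] x) :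
    Coalgebra.counit (R := ℂ) x = 0 := by
  have h := congrArg (fun t => Coalgebra.counit (R := ℂ) (TensorProduct.rid ℂ H t))
    (Coalgebra.lTensor_counit_comul (R := ℂ) x)
  rw [hx] at h
  simpa using h

variable (H) in
/-- The second Adams operation `x ↦ ∑ x₁ x₂`, the convolution square of the identity. -/
noncomputable def adams : Module.End ℂ H := LinearMap.mul' ℂ H ∘ₗ Coalgebra.comul

theorem adams_apply (x : H) :
    adams H x = LinearMap.mul' ℂ H (redComul H x) + (2 : ℂ) • x := by
  rw [adams, LinearMap.comp_apply, comul_eq_redComul_add]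
  simp [two_smul, add_assoc]

/-- For a cocommutative bialgebra, the Adams operation is a morphism of coalgebras. -/
theorem comul_adams [Coalgebra.IsCocomm ℂ H] (x : H) :
    Coalgebra.comul (R := ℂ) (adams H x) =
      TensorProduct.map (adams H) (adams H) (Coalgebra.comul (R := ℂ) x) :=
  (CoalgHomClass.map_comp_comul_apply
    ((Bialgebra.mulCoalgHom ℂ H).comp (Coalgebra.comulCoalgHom ℂ H)) x).symm

theorem redComul_adams [Coalgebra.IsCocomm ℂ H] (x : H) :
    redComul H (adams H x) = TensorProduct.map (adams H) (adams H) (redComul H x) := by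
  have h1 : adams H 1 = 1 := by simp [adams, Algebra.TensorProduct.one_def]
  rw [redComul_apply, redComul_apply, comul_adams, map_sub, map_sub, TensorProduct.map_tmul,
    TensorProduct.map_tmul, h1]

variable (𝒜 : ℕ → Submodule ℂ H)

/-- The part of degree `n` of `H₊ ⊗ H₊`, where `H₊` is the part of positive degree. -/
def posTensor (n : ℕ) : Submodule ℂ (H ⊗[ℂ] H) :=
  Submodule.span ℂ
    {z | ∃ i j : ℕ, 0 < i ∧ 0 < j ∧ i + j = n ∧ ∃ x ∈ 𝒜 i, ∃ y ∈ 𝒜 j, z = x ⊗ₜ[ℂ] y}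

theorem mul'_mem_decPart {n : ℕ} {t : H ⊗[ℂ] H} (ht : t ∈ posTensor 𝒜 n) :
    LinearMap.mul' ℂ H t ∈ decPart 𝒜 n := by
  have : posTensor 𝒜 n ≤ (decPart 𝒜 n).comap (LinearMap.mul' ℂ H) := by
    rw [posTensor, Submodule.span_le]
    rintro _ ⟨i, j, hi, hj, hij, x, hx, y, hy, rfl⟩
    exact Submodule.subset_span ⟨i, j, hi, hj, hij, x, hx, y, hy, by simp⟩
  exact this ht

variable {𝒜}

theorem redComul_mem_posTensor (h0 : 𝒜 0 ≤ Submodule.span ℂ {1})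
    (hcomul : ∀ n, ∀ x ∈ 𝒜 n, Coalgebra.comul (R := ℂ) x ∈
      ⨆ (i : ℕ) (j : ℕ) (_ : i + j = n),
        LinearMap.range (TensorProduct.map (𝒜 i).subtype (𝒜 j).subtype))
    (hcounit : ∀ n, n ≠ 0 → ∀ x ∈ 𝒜 n, Coalgebra.counit (R := ℂ) x = 0)
    {n : ℕ} (hn : 0 < n) {x : H} (hx : x ∈ 𝒜 n) : redComul H x ∈ posTensor 𝒜 n := by
  have hle : (⨆ (i : ℕ) (j : ℕ) (_ : i + j = n),
      LinearMap.range (TensorProduct.map (𝒜 i).subtype (𝒜 j).subtype)) ≤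
      ((𝒜 n).map ((TensorProduct.mk ℂ H H).flip 1) ⊔ (𝒜 n).map (TensorProduct.mk ℂ H H 1)) ⊔
        posTensor 𝒜 n := by
    refine iSup_le fun i => iSup_le fun j => iSup_le fun hij => ?_
    rintro _ ⟨t, rfl⟩
    induction t with
    | zero => simp
    | add s t hs ht => rw [map_add]; exact Submodule.add_mem _ hs ht
    | tmul y z =>
      rw [TensorProduct.map_tmul, Submodule.subtype_apply, Submodule.subtype_apply]
      rcases Nat.eq_zero_or_pos i with rfl | hi
      · obtain ⟨c, hc⟩ := Submodule.mem_span_singleton.1 (h0 y.2)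
        refine Submodule.mem_sup_left (Submodule.mem_sup_right ⟨c • (z : H), ?_, ?_⟩)
        · obtain rfl : j = n := by omega
          exact Submodule.smul_mem _ _ z.2
        · rw [← hc, TensorProduct.mk_apply, TensorProduct.tmul_smul, TensorProduct.smul_tmul']
      rcases Nat.eq_zero_or_pos j with rfl | hj
      · obtain ⟨c, hc⟩ := Submodule.mem_span_singleton.1 (h0 z.2)
        refine Submodule.mem_sup_left (Submodule.mem_sup_left ⟨c • (y : H), ?_, ?_⟩)
        · obtain rfl : i = n := by omega
          exact Submodule.smul_mem _ _ y.2
        · rw [← hc, LinearMap.flip_apply, TensorProduct.mk_apply, TensorProduct.tmul_smul,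
            TensorProduct.smul_tmul']
      exact Submodule.mem_sup_right
        (Submodule.subset_span ⟨i, j, hi, hj, hij, y, y.2, z, z.2, rfl⟩)
  obtain ⟨s, hs, p, hp, hsp⟩ := Submodule.mem_sup.1 (hle (hcomul n x hx))
  obtain ⟨_, ⟨y, hy, rfl⟩, _, ⟨z, hz, rfl⟩, rfl⟩ := Submodule.mem_sup.1 hs
  simp only [LinearMap.flip_apply, TensorProduct.mk_apply] at hsp
  -- the counit identities give `y = x` and `z = x`
  have hp1 : (Coalgebra.counit (R := ℂ) (A := H)).lTensor H p = 0 := by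
    have : posTensor 𝒜 n ≤ LinearMap.ker ((Coalgebra.counit (R := ℂ) (A := H)).lTensor H) := by
      rw [posTensor, Submodule.span_le]
      rintro _ ⟨i, j, hi, hj, hij, x, hx, y, hy, rfl⟩
      simp [hcounit j hj.ne' y hy]
    exact this hp
  have hp2 : (Coalgebra.counit (R := ℂ) (A := H)).rTensor H p = 0 := by
    have : posTensor 𝒜 n ≤ LinearMap.ker ((Coalgebra.counit (R := ℂ) (A := H)).rTensor H) := by
      rw [posTensor, Submodule.span_le]
      rintro _ ⟨i, j, hi, hj, hij, x, hx, y, hy, rfl⟩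
      simp [hcounit i hi.ne' x hx]
    exact this hp
  have hy' : y = x := by
    have := congrArg (TensorProduct.rid ℂ H) (Coalgebra.lTensor_counit_comul (R := ℂ) x)
    rw [← hsp, map_add, hp1] at this
    simpa [hcounit n hn.ne' z hz] using this
  have hz' : z = x := by
    have := congrArg (TensorProduct.lid ℂ H) (Coalgebra.rTensor_counit_comul (R := ℂ) x)
    rw [← hsp, map_add, hp2] at this
    simpa [hcounit n hn.ne' y hy] using this
  have : redComul H x = p := by
    rw [redComul_apply, ← hsp, hy', hz']
    abel
  rwa [this]

end Primitive

section Hopf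

variable {H : Type*} [Ring H] [HopfAlgebra ℂ H] {𝒜 : ℕ → Submodule ℂ H}

theorem mem_primitives_iff {x : H} : x ∈ primitives H ↔ redComul H x = 0 := by
  rw [redComul_apply, sub_sub, sub_eq_zero]
  rfl

theorem primPart_zero_eq_bot (h0 : 𝒜 0 ≤ Submodule.span ℂ {1}) : primPart 𝒜 0 = ⊥ := by
  rw [eq_bot_iff]
  rintro x ⟨hx, hx0⟩
  obtain ⟨c, rfl⟩ := Submodule.mem_span_singleton.1 (h0 hx0)
  have := counit_of_comul hx
  rw [map_smul, Bialgebra.counit_one, smul_eq_mul, mul_one] at this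
  simp [this]

theorem derivedPart_le_decPart (h0 : 𝒜 0 ≤ Submodule.span ℂ {1}) (n : ℕ) :
    derivedPart 𝒜 n ≤ decPart 𝒜 n := by
  rw [derivedPart, Submodule.span_le]
  rintro _ ⟨i, j, hij, x, hx, y, hy, rfl⟩
  rcases Nat.eq_zero_or_pos i with rfl | hi
  · rw [primPart_zero_eq_bot h0, Submodule.mem_bot] at hx
    simp [hx]
  rcases Nat.eq_zero_or_pos j with rfl | hj
  · rw [primPart_zero_eq_bot h0, Submodule.mem_bot] at hy
    simp [hy]
  exact Submodule.sub_mem _ (Submodule.subset_span ⟨i, j, hi, hj, hij, x, hx.2, y, hy.2, rfl⟩)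
    (Submodule.subset_span ⟨j, i, hj, hi, by omega, y, hy.2, x, hx.2, rfl⟩)

theorem lie_mem_primitives {x y : H} (hx : x ∈ primitives H) (hy : y ∈ primitives H) :
    x * y - y * x ∈ primitives H := by
  change Coalgebra.comul (R := ℂ) _ = _
  have hx' : Coalgebra.comul (R := ℂ) x = _ := hx
  have hy' : Coalgebra.comul (R := ℂ) y = _ := hy
  rw [map_sub, Bialgebra.comul_mul, Bialgebra.comul_mul, hx', hy']
  simp only [add_mul, mul_add, Algebra.TensorProduct.tmul_mul_tmul, one_mul, mul_one,
    TensorProduct.sub_tmul, TensorProduct.tmul_sub]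
  abel

variable [GradedAlgebra 𝒜]

theorem derivedPart_le_primPart (n : ℕ) : derivedPart 𝒜 n ≤ primPart 𝒜 n := by
  rw [derivedPart, Submodule.span_le]
  rintro _ ⟨i, j, rfl, x, hx, y, hy, rfl⟩
  refine ⟨lie_mem_primitives hx.1 hy.1, Submodule.sub_mem _ ?_ ?_⟩
  · exact SetLike.GradedMul.mul_mem hx.2 hy.2
  · rw [add_comm]
    exact SetLike.GradedMul.mul_mem hy.2 hx.2

theorem adams_mem (hH : IsFGCCHA 𝒜) (h0 : 𝒜 0 ≤ Submodule.span ℂ {1}) {n : ℕ} (hn : 0 < n) {x : H}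
    (hx : x ∈ 𝒜 n) : adams H x ∈ 𝒜 n := by
  rw [adams_apply]
  exact Submodule.add_mem _ (decPart_le 𝒜 n (mul'_mem_decPart 𝒜
    (redComul_mem_posTensor h0 hH.comul_mem hH.counit_eq_zero hn hx))) (Submodule.smul_mem _ _ hx)

theorem two_pow_injective : Function.Injective fun k : ℕ => (2 ^ k : ℂ) := by
  intro k l h
  have h' : (2 : ℕ) ^ k = 2 ^ l := by
    simp only at h
    exact_mod_cast h
  exact (Nat.pow_right_inj (by norm_num)).1 h'

theorem two_pow_add_two_ne (k : ℕ) : (2 ^ (k + 2) : ℂ) ≠ 2 := fun h => by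
  have := two_pow_injective (h.trans (pow_one 2).symm)
  omega

/-- Products of eigenvectors are eigenvectors of the tensor square. -/
theorem tmul_mem_iSup_eigenspace {f : Module.End ℂ H} {x y : H}
    (hx : x ∈ ⨆ k : ℕ, f.eigenspace (2 ^ (k + 1) : ℂ))
    (hy : y ∈ ⨆ k : ℕ, f.eigenspace (2 ^ (k + 1) : ℂ)) :
    x ⊗ₜ[ℂ] y ∈ ⨆ k : ℕ, Module.End.eigenspace (TensorProduct.map f f) (2 ^ (k + 2) : ℂ) := by
  set S := ⨆ k : ℕ, Module.End.eigenspace (TensorProduct.map f f) (2 ^ (k + 2) : ℂ) with hS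
  have h1 : ∀ k : ℕ, ∀ x ∈ f.eigenspace (2 ^ (k + 1) : ℂ),
      (⨆ k : ℕ, f.eigenspace (2 ^ (k + 1) : ℂ)) ≤ S.comap (TensorProduct.mk ℂ H H x) := by
    intro k x hx
    refine iSup_le fun l y hy => ?_
    refine Submodule.mem_iSup_of_mem (k + l) (Module.End.mem_eigenspace_iff.2 ?_)
    rw [TensorProduct.mk_apply, TensorProduct.map_tmul, Module.End.mem_eigenspace_iff.1 hx,
      Module.End.mem_eigenspace_iff.1 hy, TensorProduct.smul_tmul_smul]
    congr 1
    ring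
  have h2 : (⨆ k : ℕ, f.eigenspace (2 ^ (k + 1) : ℂ)) ≤
      S.comap ((TensorProduct.mk ℂ H H).flip y) := iSup_le fun k x hx => h1 k x hx hy
  exact h2 hx

/-- In positive degree, `H` is spanned by primitive elements, which are eigenvectors of the Adams
operation with eigenvalue `2`, and by eigenvectors with the eigenvalues `4, 8, 16, …`. -/
theorem gradedPart_le_primPart_sup_eigenspaces (hH : IsFGCCHA 𝒜)
    (h0 : 𝒜 0 ≤ Submodule.span ℂ {1}) (n : ℕ) (hn : 0 < n) :
    𝒜 n ≤ primPart 𝒜 n ⊔ ⨆ k : ℕ, ((adams H).eigenspace (2 ^ (k + 2) : ℂ) ⊓ 𝒜 n) := by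
  have := hH.cocomm
  induction n using Nat.strong_induction_on with
  | _ n ih =>
    have ih' : ∀ i, 0 < i → i < n → 𝒜 i ≤ ⨆ k : ℕ, (adams H).eigenspace (2 ^ (k + 1) : ℂ) := by
      intro i hi hin
      have h1 : primPart 𝒜 i ≤ ⨆ k : ℕ, (adams H).eigenspace (2 ^ (k + 1) : ℂ) := by
        refine le_trans (fun x hx => Module.End.mem_eigenspace_iff.2 ?_)
          (le_iSup (fun k => (adams H).eigenspace (2 ^ (k + 1) : ℂ)) 0)
        rw [adams_apply, mem_primitives_iff.1 hx.1]
        simp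
      have h2 : (⨆ k : ℕ, ((adams H).eigenspace (2 ^ (k + 2) : ℂ) ⊓ 𝒜 i)) ≤
          ⨆ k : ℕ, (adams H).eigenspace (2 ^ (k + 1) : ℂ) := iSup_le fun k => by
        refine le_iSup_of_le (k + 1) ?_
        rw [add_assoc k 1 1]
        exact inf_le_left
      exact (ih i hin hi).trans (sup_le h1 h2)
    set T : Module.End ℂ (H ⊗[ℂ] H) := TensorProduct.map (adams H) (adams H) with hT
    have htens : posTensor 𝒜 n ≤ ⨆ k : ℕ, T.eigenspace (2 ^ (k + 2) : ℂ) := by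
      rw [posTensor, Submodule.span_le]
      rintro _ ⟨i, j, hi, hj, hij, x, hx, y, hy, rfl⟩
      exact tmul_mem_iSup_eigenspace (ih' i hi (by omega) hx) (ih' j hj (by omega) hy)
    intro x hx
    have hδ := htens (redComul_mem_posTensor h0 hH.comul_mem hH.counit_eq_zero hn hx)
    obtain ⟨s, hs⟩ := Submodule.mem_iSup_iff_exists_finset.1 hδ
    have hpow : Function.Injective fun k : ℕ => (2 ^ (k + 2) : ℂ) :=
      two_pow_injective.comp (add_left_injective 2)
    have hne : ∀ k : ℕ, (2 ^ (k + 2) : ℂ) ≠ 2 := two_pow_add_two_ne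
    have hmem := mem_ker_sup_eigenspaces (c := (2 : ℂ)) (redComul_adams (H := H))
      (fun x => adams_mem hH h0 hn)
      (fun x _ h => by rw [adams_apply, h, map_zero, zero_add]) hpow hne s x hx hs
    have h1 : 𝒜 n ⊓ LinearMap.ker (redComul H) ≤ primPart 𝒜 n :=
      fun y hy => ⟨mem_primitives_iff.2 hy.2, hy.1⟩
    have h2 : (⨆ k ∈ s, ((adams H).eigenspace (2 ^ (k + 2) : ℂ) ⊓ 𝒜 n)) ≤
        ⨆ k : ℕ, ((adams H).eigenspace (2 ^ (k + 2) : ℂ) ⊓ 𝒜 n) :=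
      iSup₂_le fun k _ => le_iSup (fun k : ℕ => (adams H).eigenspace (2 ^ (k + 2) : ℂ) ⊓ 𝒜 n) k
    exact sup_le_sup h1 h2 hmem

/-- Every homogeneous element of positive degree is primitive up to decomposable elements. -/
theorem gradedPart_le_primPart_sup_decPart (hH : IsFGCCHA 𝒜)
    (h0 : 𝒜 0 ≤ Submodule.span ℂ {1}) {n : ℕ} (hn : 0 < n) :
    𝒜 n ≤ primPart 𝒜 n ⊔ decPart 𝒜 n := by
  refine (gradedPart_le_primPart_sup_eigenspaces hH h0 n hn).trans
    (sup_le_sup_left (iSup_le fun k => ?_) _)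
  rintro x ⟨hx, hxn⟩
  -- the Adams operation acts as `2` modulo decomposable elements
  have h1 := mul'_mem_decPart 𝒜
    (redComul_mem_posTensor h0 hH.comul_mem hH.counit_eq_zero hn hxn)
  have h2 : LinearMap.mul' ℂ H (redComul H x) = ((2 ^ (k + 2) : ℂ) - 2) • x := by
    rw [sub_smul, ← Module.End.mem_eigenspace_iff.1 hx, adams_apply, add_sub_cancel_right]
  have hne : (2 ^ (k + 2) : ℂ) - 2 ≠ 0 := sub_ne_zero.2 (two_pow_add_two_ne k)
  rw [h2] at h1
  exact ((decPart 𝒜 n).smul_mem_iff hne).1 h1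

/-- A cocommutative graded Hopf algebra which is free on homogeneous elements of positive degree is
free on as many homogeneous primitive elements. -/
theorem exists_primitive_gens (hH : IsFGCCHA 𝒜) (hfin : ∀ n, Module.Finite ℂ (𝒜 n))
    {a : ℕ+ → ℕ} {g : Alphabet a → H} (hg : ∀ x, g x ∈ 𝒜 (letterDeg a x))
    (hfree : Function.Bijective (FreeAlgebra.lift ℂ g)) :
    ∃ f : Alphabet a → H, (∀ x, f x ∈ primPart 𝒜 (letterDeg a x)) ∧
      Function.Bijective (FreeAlgebra.lift ℂ f) := by
  have h0 := gradedPart_zero_le 𝒜 letterDeg_pos hg ((bijective_lift_iff (K := ℂ) g).1 hfree).2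
  have h : ∀ x, ∃ y ∈ primPart 𝒜 (letterDeg a x), ∃ z ∈ decPart 𝒜 (letterDeg a x), y + z = g x :=
    fun x => Submodule.mem_sup.1 (gradedPart_le_primPart_sup_decPart hH h0 (letterDeg_pos x) (hg x))
  choose f hf z hz hfz using h
  refine ⟨f, hf, bijective_lift_of_span_decPart hfin hg hfree (fun x => (hf x).2) fun x => ?_⟩
  rw [← hfz x]
  exact Submodule.add_mem_sup (Submodule.subset_span ⟨x, rfl, rfl⟩) (hz x)

end Hopf

/-! ### Primitive elements of a free algebra on primitive generators -/

section Dynkin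

variable {H X : Type*} [Ring H] {g : X → H}

/-- The right-normed bracket `[x₁, [x₂, … [x_{k-1}, x_k] … ]]` of the letters of a word; it is `0`
for the empty word. -/
def lieWord (g : X → H) : List X → H
  | [] => 0
  | [x] => g x
  | x :: y :: w => g x * lieWord g (y :: w) - lieWord g (y :: w) * g x

theorem lieWord_mem_span_length [Algebra ℂ H] (w : List X) :
    lieWord g w ∈ Submodule.span ℂ (wordProd g '' {u | u.length = w.length}) := by
  induction w with
  | nil => exact Submodule.zero_mem _
  | cons x w ih =>
    cases w with
    | nil => exact Submodule.subset_span ⟨[x], rfl, by simp [lieWord]⟩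
    | cons y w =>
      have hx : g x ∈ Submodule.span ℂ (wordProd g '' {u | u.length = 1}) :=
        Submodule.subset_span ⟨[x], rfl, by simp⟩
      refine Submodule.sub_mem _ (mul_mem_span_words (fun u hu v hv => ?_) hx ih)
        (mul_mem_span_words (fun u hu v hv => ?_) ih hx)
      · simp only [Set.mem_ofPred_eq, List.length_append, List.length_cons] at *
        omega
      · simp only [Set.mem_ofPred_eq, List.length_append, List.length_cons] at *
        omega

variable [HopfAlgebra ℂ H] {𝒜 : ℕ → Submodule ℂ H} [GradedAlgebra 𝒜] {deg : X → ℕ}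

theorem lieWord_mem_primPart (hg : ∀ x, g x ∈ primPart 𝒜 (deg x)) (w : List X) :
    lieWord g w ∈ primPart 𝒜 (wordDeg deg w) := by
  induction w with
  | nil => exact Submodule.zero_mem _
  | cons x w ih =>
    cases w with
    | nil => simpa [lieWord] using hg x
    | cons y w =>
      rw [wordDeg_cons]
      exact derivedPart_le_primPart _
        (Submodule.subset_span ⟨_, _, rfl, g x, hg x, _, ih, rfl⟩)

theorem lieWord_mem_letters_sup_derivedPart (hg : ∀ x, g x ∈ primPart 𝒜 (deg x)) (w : List X) :
    lieWord g w ∈ Submodule.span ℂ (g '' {x | deg x = wordDeg deg w}) ⊔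
      derivedPart 𝒜 (wordDeg deg w) := by
  match w with
  | [] => exact Submodule.zero_mem _
  | [x] => exact Submodule.mem_sup_left (Submodule.subset_span ⟨x, by simp, rfl⟩)
  | x :: y :: w =>
    refine Submodule.mem_sup_right ?_
    rw [wordDeg_cons]
    exact Submodule.subset_span
      ⟨_, _, rfl, g x, hg x, _, lieWord_mem_primPart hg (y :: w), rfl⟩

theorem counit_wordProd (hg : ∀ x, g x ∈ primitives H) {w : List X} (hw : w ≠ []) :
    Coalgebra.counit (R := ℂ) (wordProd g w) = 0 := by
  cases w with
  | nil => exact absurd rfl hw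
  | cons x w => rw [wordProd_cons, Bialgebra.counit_mul, counit_of_comul (hg x), zero_mul]

/-- The identity `D * id = E` in the convolution algebra, where `D` is the Dynkin operator, which
maps each word to its right-normed bracket, and `E` multiplies each word by its length. -/
theorem mul'_rTensor_comul_wordProd (hg : ∀ x, g x ∈ primitives H)
    (hs : Submodule.span ℂ (Set.range (wordProd g)) = ⊤) (D : Module.End ℂ H)
    (hD : ∀ w, D (wordProd g w) = lieWord g w) (w : List X) :
    LinearMap.mul' ℂ H (D.rTensor H (Coalgebra.comul (R := ℂ) (wordProd g w))) =
      (w.length : ℂ) • wordProd g w := by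
  have hD1 : D 1 = 0 := hD []
  have hrec : ∀ x u, D (g x * u) =
      g x * D u - D u * g x + Coalgebra.counit (R := ℂ) u • g x := by
    intro x u
    have hu : u ∈ Submodule.span ℂ (Set.range (wordProd g)) := hs ▸ trivial
    induction hu using Submodule.span_induction with
    | mem u hu =>
      obtain ⟨w, rfl⟩ := hu
      rw [← wordProd_cons, hD, hD]
      cases w with
      | nil => simp [lieWord]
      | cons y w => rw [counit_wordProd hg (by simp), zero_smul, add_zero]; rfl
    | zero => simp
    | add u v _ _ hu hv =>
      rw [mul_add, map_add, hu, hv, map_add, map_add, mul_add, add_mul, add_smul]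
      abel
    | smul c u _ hu =>
      rw [mul_smul_comm, map_smul, hu, map_smul, map_smul, mul_smul_comm, smul_mul_assoc,
        smul_add, smul_sub, smul_assoc]
  have htens : ∀ x (t : H ⊗[ℂ] H),
      LinearMap.mul' ℂ H (D.rTensor H ((g x ⊗ₜ[ℂ] 1 + 1 ⊗ₜ[ℂ] g x) * t)) =
        g x * LinearMap.mul' ℂ H (D.rTensor H t) +
          g x * TensorProduct.lid ℂ H ((Coalgebra.counit (R := ℂ) (A := H)).rTensor H t) := by
    intro x t
    induction t with
    | zero => simp
    | add s t hs ht =>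
      rw [mul_add, map_add, map_add, hs, ht]
      simp only [map_add, mul_add]
      abel
    | tmul u v =>
      simp only [add_mul, Algebra.TensorProduct.tmul_mul_tmul, one_mul, map_add,
        LinearMap.rTensor_tmul, LinearMap.mul'_apply, hrec, TensorProduct.lid_tmul, sub_mul,
        smul_mul_assoc, mul_smul_comm, mul_assoc]
      abel
  induction w with
  | nil => simp [Algebra.TensorProduct.one_def, hD1]
  | cons x w ih =>
    have hx : Coalgebra.comul (R := ℂ) (g x) = _ := hg x
    rw [wordProd_cons, Bialgebra.comul_mul, hx, htens, ih, Coalgebra.rTensor_counit_comul,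
      TensorProduct.lid_tmul, one_smul, mul_smul_comm, List.length_cons, Nat.cast_succ, add_smul,
      one_smul]

/-- The Dynkin–Specht–Wever theorem and Friedrichs' criterion: a homogeneous primitive element of
an algebra that is free on homogeneous primitive generators is a linear combination of generators
and of commutators of primitive elements. -/
theorem primPart_le_letters_sup_derivedPart
    (hg : ∀ x, g x ∈ primPart 𝒜 (deg x)) (hfree : Function.Bijective (FreeAlgebra.lift ℂ g))
    {n : ℕ} (hn : 0 < n) :
    primPart 𝒜 n ≤ Submodule.span ℂ (g '' {x | deg x = n}) ⊔ derivedPart 𝒜 n := by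
  obtain ⟨hli, hs⟩ := (bijective_lift_iff (K := ℂ) g).1 hfree
  let b : Module.Basis (List X) ℂ H := Module.Basis.mk hli hs.ge
  have hb : ∀ w, b w = wordProd g w := fun w => Module.Basis.mk_apply _ _ w
  let D : Module.End ℂ H := b.constr ℂ (lieWord g)
  have hD : ∀ w, D (wordProd g w) = lieWord g w := fun w => by
    rw [← hb, Module.Basis.constr_basis]
  let E : Module.End ℂ H := b.constr ℂ fun w => (w.length : ℂ)⁻¹ • wordProd g w
  have hE : ∀ w, E (wordProd g w) = (w.length : ℂ)⁻¹ • wordProd g w := fun w => by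
    rw [← hb, Module.Basis.constr_basis, hb]
  have hEL : ∀ w, E (lieWord g w) = (w.length : ℂ)⁻¹ • lieWord g w := by
    intro w
    have : Submodule.span ℂ (wordProd g '' {u | u.length = w.length}) ≤
        LinearMap.eqLocus E ((w.length : ℂ)⁻¹ • LinearMap.id) := by
      rw [Submodule.span_le]
      rintro _ ⟨u, hu, rfl⟩
      have hu' : u.length = w.length := hu
      simp [LinearMap.mem_eqLocus, hE, hu']
    exact this (lieWord_mem_span_length w)
  rintro x ⟨hx, hxn⟩
  -- a primitive element `x` satisfies `(D * id)(x) = D x`, and `E` inverts `D * id`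
  have h1 : LinearMap.mul' ℂ H (D.rTensor H (Coalgebra.comul (R := ℂ) x)) = D x := by
    have hx' : Coalgebra.comul (R := ℂ) x = _ := hx
    have hD1 : D 1 = 0 := hD []
    rw [hx']
    simp [hD1]
  rw [← span_fiber_eq 𝒜 (wordProd_mem 𝒜 fun x => (hg x).2) hs n] at hxn
  have h2 : x = E (LinearMap.mul' ℂ H (D.rTensor H (Coalgebra.comul (R := ℂ) x))) := by
    have : Submodule.span ℂ (Set.range fun w : {w // wordDeg deg w = n} => wordProd g w) ≤
        LinearMap.eqLocus LinearMap.id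
          (E ∘ₗ LinearMap.mul' ℂ H ∘ₗ D.rTensor H ∘ₗ Coalgebra.comul) := by
      rw [Submodule.span_le]
      rintro _ ⟨⟨w, hw⟩, rfl⟩
      have hw0 : (w.length : ℂ) ≠ 0 := by
        rw [Nat.cast_ne_zero, ← Nat.pos_iff_ne_zero, List.length_pos_iff]
        rintro rfl
        exact hn.ne hw
      simp only [SetLike.mem_coe, LinearMap.mem_eqLocus, LinearMap.comp_apply, LinearMap.id_apply]
      rw [mul'_rTensor_comul_wordProd (fun x => (hg x).1) hs D hD, map_smul, hE, smul_smul,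
        mul_inv_cancel₀ hw0, one_smul]
    exact this hxn
  rw [h2, h1]
  have h3 : Submodule.span ℂ (Set.range fun w : {w // wordDeg deg w = n} => wordProd g w) ≤
      (Submodule.span ℂ (g '' {x | deg x = n}) ⊔ derivedPart 𝒜 n).comap (E ∘ₗ D) := by
    rw [Submodule.span_le]
    rintro _ ⟨⟨w, rfl⟩, rfl⟩
    simp only [SetLike.mem_coe, Submodule.mem_comap, LinearMap.comp_apply, hD, hEL]
    exact Submodule.smul_mem _ _ (lieWord_mem_letters_sup_derivedPart hg w)
  exact h3 hxn

end Dynkin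

/-! ### Ordered monomials in a basis of the primitive elements -/

theorem exists_dual_of_linearIndependent {K V ι : Type*} [Field K] [AddCommGroup V] [Module K V]
    {v : ι → V} (hv : LinearIndependent K v) (i : ι) :
    ∃ φ : V →ₗ[K] K, φ (v i) = 1 ∧ ∀ j, j ≠ i → φ (v j) = 0 := by
  classical
  obtain ⟨φ, hφ⟩ := LinearMap.exists_extend (Finsupp.lapply (R := K) i ∘ₗ hv.repr)
  have h : ∀ j, φ (v j) = Finsupp.single j (1 : K) i := by
    intro j
    have := LinearMap.congr_fun hφ ⟨v j, Submodule.subset_span ⟨j, rfl⟩⟩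
    rw [LinearMap.comp_apply, Submodule.subtype_apply] at this
    rw [this, LinearMap.comp_apply, hv.repr_eq_single j _ rfl]
    rfl
  exact ⟨φ, by simp [h], fun j hj => by rw [h, Finsupp.single_eq_of_ne hj.symm]⟩

theorem sum_map_ite_eq_count {α R : Type*} [DecidableEq α] [Semiring R] (a : α) (s : Multiset α) :
    (s.map fun b => if a = b then (1 : R) else 0).sum = (s.count a : R) := by
  induction s using Multiset.induction_on with
  | empty => simp
  | cons b s ih =>
    rw [Multiset.map_cons, Multiset.sum_cons, ih, Multiset.count_cons]
    split_ifs <;> simp [add_comm]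

section Reorder

variable {H I : Type*} [Ring H] [Algebra ℂ H] {y : I → H}

/-- Reordering a product of elements of a Lie algebra changes it by shorter products. -/
theorem wordProd_sub_wordProd_mem_of_perm
    (hlie : ∀ i j, y i * y j - y j * y i ∈ Submodule.span ℂ (Set.range y)) {l l' : List I}
    (h : l.Perm l') : wordProd y l - wordProd y l' ∈
      Submodule.span ℂ (wordProd y '' {u | u.length < l.length}) := by
  induction h with
  | nil => simp
  | cons i h ih =>
    rw [wordProd_cons, wordProd_cons, ← mul_sub]
    refine mul_mem_span_words (w₁ := {u | u = [i]}) (fun u hu v hv => ?_)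
      (Submodule.subset_span ⟨[i], rfl, by simp⟩) ih
    simp only [Set.mem_ofPred_eq, List.length_cons] at *
    simp [hu]
    omega
  | swap i j l =>
    have : wordProd y (j :: i :: l) - wordProd y (i :: j :: l) =
        (y j * y i - y i * y j) * wordProd y l := by
      simp only [wordProd_cons, sub_mul, mul_assoc]
    rw [this]
    have hsub : Set.range y ⊆ wordProd y '' {u | u.length = 1} := by
      rintro _ ⟨k, rfl⟩
      exact ⟨[k], rfl, by simp⟩
    refine mul_mem_span_words (w₂ := {u | u = l}) (fun u hu v hv => ?_)
      (Submodule.span_mono hsub (hlie j i)) (Submodule.subset_span ⟨l, rfl, rfl⟩)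
    simp only [Set.mem_ofPred_eq, List.length_cons, List.length_append] at *
    rw [hv]
    omega
  | trans h₁ h₂ ih₁ ih₂ =>
    rw [← h₁.length_eq] at ih₂
    rw [← sub_add_sub_cancel]
    exact Submodule.add_mem _ ih₁ ih₂

end Reorder

section Ordered

variable {H I : Type*} [Ring H] [LinearOrder I]

/-- The product, in increasing order, of the members of the family `y` given by a multiset of
indices. -/
def orderedProd (y : I → H) (m : Multiset I) : H := wordProd y (m.sort (· ≤ ·))

@[simp] theorem orderedProd_zero (y : I → H) : orderedProd y 0 = 1 := by simp [orderedProd]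

theorem orderedProd_cons (y : I → H) {i : I} {m : Multiset I} (h : ∀ j ∈ m, i ≤ j) :
    orderedProd y (i ::ₘ m) = y i * orderedProd y m := by
  rw [orderedProd, Multiset.sort_cons _ _ _ h, wordProd_cons, orderedProd]

theorem orderedProd_singleton (y : I → H) (i : I) : orderedProd y {i} = y i := by
  simp [orderedProd]

theorem orderedProd_mem [Algebra ℂ H] (𝒜 : ℕ → Submodule ℂ H) [GradedAlgebra 𝒜] {deg : I → ℕ}
    {y : I → H} (hy : ∀ i, y i ∈ 𝒜 (deg i)) (m : Multiset I) :
    orderedProd y m ∈ 𝒜 (m.map deg).sum := by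
  have h1 := wordProd_mem 𝒜 hy (m.sort (· ≤ ·))
  have h2 : wordDeg deg (m.sort (· ≤ ·)) = (m.map deg).sum := by
    conv_rhs => rw [← Multiset.sort_eq m (· ≤ ·)]
    rw [Multiset.map_coe, Multiset.sum_coe, wordDeg]
  rwa [h2] at h1

section Bialgebra

variable [HopfAlgebra ℂ H] {y : I → H}

/-- The comultiplication splits an ordered monomial in primitive elements, in all possible ways,
into two ordered monomials. -/
theorem comul_orderedProd (hy : ∀ i, y i ∈ primitives H) (m : Multiset I) :
    Coalgebra.comul (R := ℂ) (orderedProd y m) =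
      (m.antidiagonal.map fun p => orderedProd y p.1 ⊗ₜ[ℂ] orderedProd y p.2).sum := by
  have key : ∀ l : List I, l.Pairwise (· ≤ ·) →
      Coalgebra.comul (R := ℂ) (orderedProd y (l : Multiset I)) =
        ((l : Multiset I).antidiagonal.map
          fun p => orderedProd y p.1 ⊗ₜ[ℂ] orderedProd y p.2).sum := by
    intro l hl
    induction l with
    | nil => simp [Algebra.TensorProduct.one_def]
    | cons i l ih =>
      rw [List.pairwise_cons] at hl
      have hle : ∀ j ∈ (l : Multiset I), i ≤ j := fun j hj => hl.1 j hj
      have hi : Coalgebra.comul (R := ℂ) (y i) = _ := hy i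
      rw [← Multiset.cons_coe, orderedProd_cons y hle, Bialgebra.comul_mul, hi, ih hl.2,
        Multiset.antidiagonal_cons, Multiset.map_add, Multiset.sum_add, Multiset.map_map,
        Multiset.map_map, add_mul, add_comm, ← Multiset.sum_map_mul_left,
        ← Multiset.sum_map_mul_left]
      congr 2
      · refine Multiset.map_congr rfl fun p hp => ?_
        have hp' : p.2 ≤ (l : Multiset I) := by
          rw [← Multiset.mem_antidiagonal.1 hp]; exact Multiset.le_add_left _ _
        simp [orderedProd_cons y fun j hj => hle j (Multiset.mem_of_le hp' hj)]
      · refine Multiset.map_congr rfl fun p hp => ?_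
        have hp' : p.1 ≤ (l : Multiset I) := by
          rw [← Multiset.mem_antidiagonal.1 hp]; exact Multiset.le_add_right _ _
        simp [orderedProd_cons y fun j hj => hle j (Multiset.mem_of_le hp' hj)]
  have := key (m.sort (· ≤ ·)) (Multiset.pairwise_sort _ _)
  rwa [Multiset.sort_eq] at this

theorem counit_orderedProd (hy : ∀ i, y i ∈ primitives H) {m : Multiset I} (hm : m ≠ 0) :
    Coalgebra.counit (R := ℂ) (orderedProd y m) = 0 := by
  refine counit_wordProd hy fun h => hm ?_
  rw [← Multiset.sort_eq m (· ≤ ·), h]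
  rfl

/-- A linear relation between ordered monomials of length at most one is trivial. -/
theorem eq_zero_of_card_le_one (hy : ∀ i, y i ∈ primitives H) (hli : LinearIndependent ℂ y)
    {f : Multiset I →₀ ℂ} (hf : ∀ m ∈ f.support, m.card ≤ 1)
    (h0 : Finsupp.linearCombination ℂ (orderedProd y) f = 0) : f = 0 := by
  have hsum : ∀ φ : H →ₗ[ℂ] ℂ, ∑ m ∈ f.support, f m * φ (orderedProd y m) = 0 := by
    intro φ
    have := congrArg φ h0
    rw [Finsupp.linearCombination_apply, map_finsuppSum, map_zero, Finsupp.sum] at this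
    simpa using this
  have hf0 : f 0 = 0 := by
    have := hsum (Coalgebra.counit (R := ℂ))
    rw [Finset.sum_eq_single 0 (fun m _ hm => by rw [counit_orderedProd hy hm, mul_zero])
      (fun h => by rw [Finsupp.notMem_support_iff.1 h, zero_mul])] at this
    simpa using this
  ext m
  by_cases hm : m ∈ f.support
  · have hc := hf m hm
    rcases Nat.lt_or_ge m.card 1 with h | h
    · obtain rfl : m = 0 := by rw [← Multiset.card_eq_zero]; omega
      exact hf0
    · obtain ⟨i, rfl⟩ := Multiset.card_eq_one.1 (le_antisymm hc h)
      obtain ⟨φ, hφ1, hφ⟩ := exists_dual_of_linearIndependent hli i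
      have := hsum φ
      rw [Finset.sum_eq_single {i} _ (fun h => absurd hm h), orderedProd_singleton, hφ1,
        mul_one] at this
      · exact this
      · intro m' hm' hne
        rcases Nat.lt_or_ge m'.card 1 with h | h
        · obtain rfl : m' = 0 := by rw [← Multiset.card_eq_zero]; omega
          rw [hf0, zero_mul]
        · obtain ⟨j, rfl⟩ := Multiset.card_eq_one.1 (le_antisymm (hf m' hm') h)
          rw [orderedProd_singleton, hφ j (by rintro rfl; exact hne rfl), mul_zero]
  · exact Finsupp.notMem_support_iff.1 hm

/-- The linear independence in the Poincaré–Birkhoff–Witt theorem: ordered monomials in linearly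
independent primitive elements are linearly independent. -/
theorem linearIndependent_orderedProd (hy : ∀ i, y i ∈ primitives H)
    (hli : LinearIndependent ℂ y) : LinearIndependent ℂ (orderedProd y) := by
  classical
  have key : ∀ k : ℕ, ∀ f : Multiset I →₀ ℂ, (∀ m ∈ f.support, m.card ≤ k) →
      Finsupp.linearCombination ℂ (orderedProd y) f = 0 → f = 0 := by
    intro k
    induction k with
    | zero =>
      exact fun f hf => eq_zero_of_card_le_one hy hli fun m hm => (hf m hm).trans zero_le_one
    | succ k ih =>
      intro f hf h0
      refine eq_zero_of_card_le_one hy hli (fun c hc => ?_) h0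
      by_contra! hc1
      -- write the exponent `c` as `a + b` with `a` and `b` nonzero
      obtain ⟨i, b, rfl⟩ : ∃ i b, c = i ::ₘ b := by
        obtain ⟨i, hi⟩ := Multiset.card_pos_iff_exists_mem.1 (by omega : 0 < c.card)
        exact ⟨i, _, (Multiset.cons_erase hi).symm⟩
      have hck := hf _ hc
      rw [Multiset.card_cons] at hc1 hck
      -- functionals that are dual to the monomials of length at most `k`
      have hlik : LinearIndependent ℂ fun m : {m : Multiset I // m.card ≤ k} =>
          orderedProd y m := by
        refine (linearIndepOn_iff (s := {m : Multiset I | m.card ≤ k}) (v := orderedProd y)).2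
          fun f hf hf0 => ih f (fun m hm => (Finsupp.mem_supported _ _).1 hf hm) hf0
      obtain ⟨φ, hφ1, hφ⟩ := exists_dual_of_linearIndependent hlik
        ⟨{i}, by rw [Multiset.card_singleton]; omega⟩
      obtain ⟨ψ, hψ1, hψ⟩ := exists_dual_of_linearIndependent hlik ⟨b, by omega⟩
      have hb0 : b ≠ 0 := by rintro rfl; simp at hc1
      have hφ' : ∀ m : Multiset I, m.card ≤ k → m ≠ {i} → φ (orderedProd y m) = 0 :=
        fun m hm hne => hφ ⟨m, hm⟩ fun h => hne (congrArg Subtype.val h)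
      have hψ' : ∀ m : Multiset I, m.card ≤ k → m ≠ b → ψ (orderedProd y m) = 0 :=
        fun m hm hne => hψ ⟨m, hm⟩ fun h => hne (congrArg Subtype.val h)
      set L : H →ₗ[ℂ] ℂ := LinearMap.mul' ℂ ℂ ∘ₗ TensorProduct.map φ ψ ∘ₗ Coalgebra.comul with hL
      have hLm : ∀ m : Multiset I, m.card ≤ k + 1 → L (orderedProd y m) =
          (m.antidiagonal.count ({i}, b) : ℂ) := by
        intro m hm
        have h1 : L (orderedProd y m) = (m.antidiagonal.map fun p =>
            φ (orderedProd y p.1) * ψ (orderedProd y p.2)).sum := by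
          rw [hL, LinearMap.comp_apply, LinearMap.comp_apply, comul_orderedProd hy,
            map_multiset_sum, map_multiset_sum, Multiset.map_map, Multiset.map_map]
          rfl
        have h2 : ∀ p ∈ m.antidiagonal, φ (orderedProd y p.1) * ψ (orderedProd y p.2) =
            if ({i}, b) = p then 1 else 0 := by
          rintro ⟨p, q⟩ hpq
          have hc : p.card + q.card = m.card := by
            rw [← Multiset.card_add, Multiset.mem_antidiagonal.1 hpq]
          simp only
          by_cases hp0 : p = 0
          · rw [hp0, hφ' 0 (by simp) (Multiset.singleton_ne_zero i).symm, zero_mul, if_neg]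
            simp
          by_cases hq0 : q = 0
          · rw [hq0, hψ' 0 (by simp) hb0.symm, mul_zero, if_neg]
            simp [hb0]
          have hp1 := Multiset.card_pos.2 hp0
          have hq1 := Multiset.card_pos.2 hq0
          by_cases hp : p = {i}
          · by_cases hq : q = b
            · rw [if_pos (by rw [hp, hq]), hp, hq, hφ1, hψ1, one_mul]
            · rw [hψ' q (by omega) hq, mul_zero, if_neg]
              simp [Ne.symm hq]
          · rw [hφ' p (by omega) hp, zero_mul, if_neg]
            simp [Ne.symm hp]
        rw [h1, Multiset.map_congr rfl h2, sum_map_ite_eq_count]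
      have hsum := congrArg L h0
      rw [Finsupp.linearCombination_apply, map_finsuppSum, map_zero, Finsupp.sum,
        Finset.sum_eq_single (i ::ₘ b) _ (fun h => absurd hc h), map_smul, smul_eq_mul,
        hLm _ (by simpa using hck), mul_eq_zero] at hsum
      · rcases hsum with h | h
        · exact Finsupp.mem_support_iff.1 hc h
        · rw [Nat.cast_eq_zero, Multiset.count_eq_zero, Multiset.mem_antidiagonal] at h
          exact h rfl
      · intro m hm hne
        rw [map_smul, hLm m (hf m hm), Multiset.count_eq_zero.2, Nat.cast_zero, smul_zero]
        rw [Multiset.mem_antidiagonal]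
        exact fun h => hne h.symm
  rw [linearIndependent_iff]
  intro f hf
  exact key (f.support.sup Multiset.card) f (fun m hm => Finset.le_sup hm) hf

end Bialgebra

variable [Algebra ℂ H] {y : I → H}

/-- The spanning part of the Poincaré–Birkhoff–Witt theorem. -/
theorem span_orderedProd_eq_top
    (hlie : ∀ i j, y i * y j - y j * y i ∈ Submodule.span ℂ (Set.range y))
    (hs : Submodule.span ℂ (Set.range (wordProd y)) = ⊤) :
    Submodule.span ℂ (Set.range (orderedProd y)) = ⊤ := by
  have key : ∀ k : ℕ, ∀ l : List I, l.length = k →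
      wordProd y l ∈ Submodule.span ℂ (Set.range (orderedProd y)) := by
    intro k
    induction k using Nat.strong_induction_on with
    | _ k ih =>
      rintro l rfl
      have hperm : l.Perm ((l : Multiset I).sort (· ≤ ·)) := by
        rw [← Multiset.coe_eq_coe, Multiset.sort_eq]
      rw [← sub_add_cancel (wordProd y l) (orderedProd y (l : Multiset I))]
      refine Submodule.add_mem _ ?_ (Submodule.subset_span ⟨_, rfl⟩)
      have h := wordProd_sub_wordProd_mem_of_perm hlie hperm
      refine (Submodule.span_le.2 ?_ : _ ≤ Submodule.span ℂ (Set.range (orderedProd y))) h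
      rintro _ ⟨u, hu, rfl⟩
      exact ih _ hu u rfl
  rw [eq_top_iff, ← hs, Submodule.span_le]
  rintro _ ⟨l, rfl⟩
  exact key _ l rfl

end Ordered

/-! ### Counting ordered monomials -/

/-- The geometric series `1 + t^d + t^{2d} + ⋯`. -/
def geomSeries (d : ℕ) : PowerSeries ℚ := PowerSeries.mk fun n => if d ∣ n then 1 else 0

theorem inv_one_sub_X_pow {d : ℕ} (hd : 0 < d) (k : ℕ) :
    ((1 - PowerSeries.X ^ d : PowerSeries ℚ) ^ k)⁻¹ = geomSeries d ^ k := by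
  have h : geomSeries d * (1 - PowerSeries.X ^ d) = 1 := by
    ext n
    rw [mul_sub, mul_one, map_sub, PowerSeries.coeff_mul_X_pow', geomSeries, PowerSeries.coeff_mk,
      PowerSeries.coeff_mk, PowerSeries.coeff_one]
    by_cases hn : d ≤ n
    · rw [if_pos hn, if_neg (by omega : n ≠ 0), sub_eq_zero]
      simp only [Nat.dvd_sub_self_right]
      have : d ∣ n ↔ d ∣ n ∨ n ≤ d := ⟨Or.inl, fun h => h.elim id
        fun h => (le_antisymm h hn).symm ▸ dvd_refl _⟩
      exact if_congr this rfl rfl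
    · rw [if_neg hn, sub_zero]
      have : d ∣ n ↔ n = 0 := ⟨fun h => by
        by_contra h0
        exact hn (Nat.le_of_dvd (Nat.pos_of_ne_zero h0) h), fun h => h ▸ dvd_zero d⟩
      simp only [this]
  rw [eq_comm, PowerSeries.eq_inv_iff_mul_eq_one (by simp [hd.ne']), ← mul_pow, h, one_pow]

section Multidegree

variable {X : Type*} {deg : X → ℕ}

theorem sum_map_eq_sum_count [DecidableEq X] {J : Finset X} {m : Multiset X} (hm : ∀ x ∈ m, x ∈ J) :
    (m.map deg).sum = ∑ x ∈ J, deg x * m.count x := by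
  rw [Finset.sum_multiset_map_count]
  simp only [smul_eq_mul]
  rw [Finset.sum_subset (fun x hx => hm x (Multiset.mem_toFinset.1 hx)) fun x _ hx => by
    rw [Multiset.count_eq_zero.2 fun h => hx (Multiset.mem_toFinset.2 h), zero_mul]]
  exact Finset.sum_congr rfl fun x _ => mul_comm _ _

/-- The number of multisets of letters of total degree `N`, as a coefficient of a product of
geometric series. -/
theorem coeff_prod_geomSeries (hdeg : ∀ x, 0 < deg x) {J : Finset X} {N : ℕ}
    (hJ : ∀ x, deg x ≤ N → x ∈ J) :
    PowerSeries.coeff N (∏ x ∈ J, geomSeries (deg x)) =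
      (Nat.card {m : Multiset X // (m.map deg).sum = N} : ℚ) := by
  classical
  rw [PowerSeries.coeff_prod]
  have hprod : ∀ l ∈ Finset.finsuppAntidiag J N,
      ∏ x ∈ J, PowerSeries.coeff (l x) (geomSeries (deg x)) =
        if ∀ x ∈ J, deg x ∣ l x then (1 : ℚ) else 0 := by
    intro l _
    simp only [geomSeries, PowerSeries.coeff_mk]
    rw [Finset.prod_ite_zero, Finset.prod_const_one]
  rw [Finset.sum_congr rfl hprod, Finset.sum_boole, Nat.cast_inj, ← Nat.card_eq_finsetCard]
  symm
  have hmem : ∀ m : {m : Multiset X // (m.map deg).sum = N}, ∀ x ∈ m.1, x ∈ J := fun m x hx =>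
    hJ x (m.2 ▸ Multiset.single_le_sum (fun _ _ => Nat.zero_le _) _
      (Multiset.mem_map_of_mem deg hx))
  -- a multiset corresponds to the function `x ↦ deg x * (multiplicity of x)`
  let F : {m : Multiset X // (m.map deg).sum = N} → X →₀ ℕ := fun m =>
    Finsupp.onFinset J (fun x => deg x * m.1.count x) fun x hx =>
      hmem m x (Multiset.count_ne_zero.1 (right_ne_zero_of_mul hx))
  have hF : ∀ m x, F m x = deg x * m.1.count x := fun m x => rfl
  refine Nat.card_eq_of_bijective (fun m => ⟨F m, Finset.mem_filter.2
    ⟨Finset.mem_finsuppAntidiag.2 ⟨?_, Finsupp.support_onFinset_subset⟩,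
      fun x _ => Dvd.intro _ rfl⟩⟩) ⟨fun m m' h => ?_, ?_⟩
  · rw [← m.2, sum_map_eq_sum_count (hmem m)]
    rfl
  · have h' : F m = F m' := congrArg Subtype.val h
    ext x
    have := DFunLike.congr_fun h' x
    rw [hF, hF] at this
    exact Nat.eq_of_mul_eq_mul_left (hdeg x) this
  · rintro ⟨l, hl⟩
    obtain ⟨hl1, hdvd⟩ := Finset.mem_filter.1 hl
    obtain ⟨hsum, hsupp⟩ := Finset.mem_finsuppAntidiag.1 hl1
    set m : Multiset X := Finsupp.toMultiset (Finsupp.onFinset J (fun x => l x / deg x)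
      fun x hx => hsupp (Finsupp.mem_support_iff.2 fun h => hx (by rw [h, Nat.zero_div])))
    have hcount : ∀ x, deg x * m.count x = l x := by
      intro x
      rw [Finsupp.count_toMultiset, Finsupp.onFinset_apply]
      refine Nat.mul_div_cancel' ?_
      by_cases hx : x ∈ J
      · exact hdvd x hx
      · rw [Finsupp.notMem_support_iff.1 fun h => hx (hsupp h)]
        exact dvd_zero _
    have hmJ : ∀ x ∈ m, x ∈ J := fun x hx => by
      refine hsupp (Finsupp.mem_support_iff.2 ?_)
      rw [← hcount]
      exact mul_ne_zero (hdeg x).ne' (Multiset.count_ne_zero.2 hx)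
    refine ⟨⟨m, ?_⟩, Subtype.ext (Finsupp.ext fun x => hcount x)⟩
    rw [sum_map_eq_sum_count hmJ, ← hsum]
    exact Finset.sum_congr rfl fun x _ => hcount x

end Multidegree

/-- The coefficients of the Euler product count the multisets of letters. -/
theorem coeff_eulerProd (p : ℕ+ → ℕ) (N : ℕ) :
    PowerSeries.coeff N (∏ k ∈ Finset.range N,
      ((1 - PowerSeries.X ^ (k + 1) : PowerSeries ℚ) ^ p k.succPNat)⁻¹) =
      (Nat.card {m : Multiset (Alphabet p) // (m.map (letterDeg p)).sum = N} : ℚ) := by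
  classical
  set J : Finset (Alphabet p) :=
    ((Finset.range N).image Nat.succPNat).sigma fun n => (Finset.univ : Finset (Fin (p n))) with hJ
  rw [← coeff_prod_geomSeries letterDeg_pos (J := J)]
  · congr 1
    rw [hJ, Finset.prod_sigma, Finset.prod_image (fun x _ y _ h => Nat.succPNat_injective h)]
    refine Finset.prod_congr rfl fun k _ => ?_
    rw [inv_one_sub_X_pow k.succ_pos]
    simp [letterDeg]
  · rintro ⟨n, i⟩ hn
    rw [hJ, Finset.mem_sigma]
    refine ⟨Finset.mem_image.2 ⟨n.natPred, ?_, PNat.succPNat_natPred n⟩, Finset.mem_univ _⟩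
    rw [Finset.mem_range]
    have h1 : (n : ℕ) ≤ N := hn
    have := n.natPred_add_one
    omega

section Euler

variable {H : Type*} [Ring H] [HopfAlgebra ℂ H] {𝒜 : ℕ → Submodule ℂ H}

theorem finite_primPart (hfin : ∀ n, Module.Finite ℂ (𝒜 n)) (n : ℕ) :
    Module.Finite ℂ (primPart 𝒜 n) :=
  have := hfin n
  Submodule.finiteDimensional_of_le (inf_le_right : primPart 𝒜 n ≤ 𝒜 n)

variable [GradedAlgebra 𝒜]

theorem wordProd_mem_span_words {X Y : Type*} {g : X → H} {y : Y → H}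
    (h : ∀ x, g x ∈ Submodule.span ℂ (Set.range y)) (w : List X) :
    wordProd g w ∈ Submodule.span ℂ (Set.range (wordProd y)) := by
  rw [← Set.image_univ]
  induction w with
  | nil => exact Submodule.subset_span ⟨[], trivial, rfl⟩
  | cons x w ih =>
    rw [wordProd_cons]
    refine mul_mem_span_words (w₁ := Set.univ) (fun u _ v _ => Set.mem_univ (u ++ v))
      (Submodule.span_mono ?_ (h x)) ih
    rintro _ ⟨i, rfl⟩
    exact ⟨[i], trivial, by simp⟩

/-- The Poincaré–Birkhoff–Witt count: if `H` is generated by homogeneous primitive elements of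
positive degree, then its Hilbert series is the Euler transform of that of `P(H)`. -/
theorem coeff_one_add_genFun_finrank (hfin : ∀ n, Module.Finite ℂ (𝒜 n))
    (h0 : 𝒜 0 ≤ Submodule.span ℂ {1}) {X : Type*} {deg : X → ℕ} {g : X → H}
    (hdeg : ∀ x, 0 < deg x) (hg : ∀ x, g x ∈ primPart 𝒜 (deg x))
    (hs : Submodule.span ℂ (Set.range (wordProd g)) = ⊤) (N : ℕ) :
    PowerSeries.coeff N (1 + genFun fun n => Module.finrank ℂ (𝒜 n)) =
      PowerSeries.coeff N (∏ k ∈ Finset.range N, ((1 - PowerSeries.X ^ (k + 1) : PowerSeries ℚ) ^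
        Module.finrank ℂ (primPart 𝒜 k.succPNat))⁻¹) := by
  classical
  set p : ℕ+ → ℕ := fun n => Module.finrank ℂ (primPart 𝒜 n) with hp
  have hPfin := finite_primPart hfin
  let b : ∀ n : ℕ+, Module.Basis (Fin (p n)) ℂ (primPart 𝒜 n) := fun n =>
    Module.finBasis ℂ (primPart 𝒜 n)
  let y : Alphabet p → H := fun x => (b x.1 x.2 : H)
  have hy : ∀ x, y x ∈ primPart 𝒜 (letterDeg p x) := fun x => (b x.1 x.2).2
  have hyspan : ∀ n : ℕ+, primPart 𝒜 n ≤ Submodule.span ℂ (Set.range y) := by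
    intro n x hx
    have h1 : (⟨x, hx⟩ : primPart 𝒜 n) ∈ Submodule.span ℂ (Set.range (b n)) := by
      rw [(b n).span_eq]; trivial
    have h2 := Submodule.mem_map_of_mem (f := (primPart 𝒜 n).subtype) h1
    rw [Submodule.map_span, ← Set.range_comp] at h2
    refine Submodule.span_mono ?_ h2
    rintro _ ⟨i, rfl⟩
    exact ⟨⟨n, i⟩, rfl⟩
  have hyli : LinearIndependent ℂ y := by
    refine linearIndependent_of_fiber 𝒜 (deg := letterDeg p) (fun x => (hy x).2) fun n => ?_
    rcases Nat.eq_zero_or_pos n with rfl | hn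
    · have : IsEmpty {x // letterDeg p x = 0} := ⟨fun x => (letterDeg_pos x.1).ne' x.2⟩
      exact linearIndependent_empty_type
    · lift n to ℕ+ using hn
      have h1 := ((b n).linearIndependent.map' (primPart 𝒜 n).subtype
        (Submodule.ker_subtype _)).comp _ (letterEquiv p n).injective
      have h2 : (fun x : {x // letterDeg p x = n} => y x) =
          ((primPart 𝒜 n).subtype ∘ b n) ∘ letterEquiv p n := by
        funext ⟨⟨m, i⟩, h⟩
        obtain rfl : m = n := PNat.coe_injective h
        rfl
      rw [h2]
      exact h1
  have hylie : ∀ i j, y i * y j - y j * y i ∈ Submodule.span ℂ (Set.range y) := fun i j =>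
    hyspan (i.1 + j.1) (derivedPart_le_primPart _ (Submodule.subset_span
      ⟨_, _, rfl, y i, hy i, y j, hy j, rfl⟩))
  have hyspan' : Submodule.span ℂ (Set.range (wordProd y)) = ⊤ := by
    rw [eq_top_iff, ← hs, Submodule.span_le]
    rintro _ ⟨w, rfl⟩
    exact wordProd_mem_span_words (fun x => hyspan ⟨deg x, hdeg x⟩ (hg x)) w
  let _ : LinearOrder (Alphabet p) := linearOrderOfSTO WellOrderingRel
  have hli := linearIndependent_orderedProd (fun x => (hy x).1) hyli
  have hspan := span_orderedProd_eq_top hylie hyspan'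
  change _ = PowerSeries.coeff N (∏ k ∈ Finset.range N,
    ((1 - PowerSeries.X ^ (k + 1) : PowerSeries ℚ) ^ p k.succPNat)⁻¹)
  rw [coeff_eulerProd,
    ← finrank_eq_card_fiber 𝒜 (orderedProd_mem 𝒜 fun x => (hy x).2) hli hspan N]
  rcases Nat.eq_zero_or_pos N with rfl | hN
  · have h1 : Module.finrank ℂ (𝒜 0) = 1 := by
      have h2 : 𝒜 0 = Submodule.span ℂ {1} :=
        le_antisymm h0 (Submodule.span_le.2 (by simpa using SetLike.GradedOne.one_mem))
      have h3 : (1 : H) ≠ 0 := fun h => by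
        have := Bialgebra.counit_one (R := ℂ) (A := H)
        rw [h, map_zero] at this
        exact zero_ne_one this
      rw [h2, finrank_span_singleton h3]
    simp [constantCoeff_genFun, h1]
  · rw [map_add, PowerSeries.coeff_one, if_neg hN.ne', zero_add, genFun, PowerSeries.coeff_mk,
      dif_pos hN]
    rfl

end Euler

/-! ### The enveloping algebra of the free Lie algebra -/

section Enveloping

variable (a : ℕ+ → ℕ)

/-- The algebra map `U(𝔏(a)) → T(ℂ X_a)` extending the inclusion of `𝔏(a)`. -/
noncomputable def toFreeAlgebra : UFreeLie a →ₐ[ℂ] FreeAlgebra ℂ (Alphabet a) :=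
  UniversalEnvelopingAlgebra.lift ℂ (freeLie a).incl

/-- The algebra map `T(ℂ X_a) → U(𝔏(a))` which maps letters to generators. -/
noncomputable def ofFreeAlgebra : FreeAlgebra ℂ (Alphabet a) →ₐ[ℂ] UFreeLie a :=
  FreeAlgebra.lift ℂ fun x => gen a x.1 x.2

theorem toFreeAlgebra_ι (x : freeLie a) :
    toFreeAlgebra a (UniversalEnvelopingAlgebra.ι ℂ x) = (x : FreeAlgebra ℂ (Alphabet a)) :=
  UniversalEnvelopingAlgebra.lift_ι_apply ℂ _ x

theorem toFreeAlgebra_gen (x : Alphabet a) :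
    toFreeAlgebra a (gen a x.1 x.2) = FreeAlgebra.ι ℂ x := toFreeAlgebra_ι a _

theorem ofFreeAlgebra_coe (x : freeLie a) :
    ofFreeAlgebra a (x : FreeAlgebra ℂ (Alphabet a)) = UniversalEnvelopingAlgebra.ι ℂ x := by
  -- the elements for which the identity holds form a Lie subalgebra containing the letters
  obtain ⟨x, hx⟩ := x
  induction hx using LieSubalgebra.lieSpan_induction with
  | mem x hx =>
    obtain ⟨⟨n, i⟩, rfl⟩ := hx
    exact FreeAlgebra.lift_ι_apply _ _
  | zero => exact (map_zero _).trans (map_zero (UniversalEnvelopingAlgebra.ι ℂ)).symm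
  | smul r x hx ih =>
    exact (map_smul _ r x).trans ((congrArg (r • ·) ih).trans
      (map_smul (UniversalEnvelopingAlgebra.ι ℂ) r (⟨x, hx⟩ : freeLie a)).symm)
  | add x y hx hy ihx ihy =>
    exact (map_add _ x y).trans ((congrArg₂ (· + ·) ihx ihy).trans
      (map_add (UniversalEnvelopingAlgebra.ι ℂ) (⟨x, hx⟩ : freeLie a) ⟨y, hy⟩).symm)
  | lie x y hx hy ihx ihy =>
    refine Eq.trans ?_
      (LieHom.map_lie (UniversalEnvelopingAlgebra.ι ℂ) (⟨x, hx⟩ : freeLie a) ⟨y, hy⟩).symm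
    simp only at ihx ihy
    simp only [LieRing.of_associative_ring_bracket, map_sub, map_mul, ihx, ihy]

/-- The enveloping algebra of the free Lie algebra is the free algebra. -/
noncomputable def uFreeLieEquiv : UFreeLie a ≃ₐ[ℂ] FreeAlgebra ℂ (Alphabet a) :=
  AlgEquiv.ofAlgHom (toFreeAlgebra a) (ofFreeAlgebra a)
    (by
      ext x
      simp only [Function.comp_apply, AlgHom.comp_apply, AlgHom.id_apply]
      rw [ofFreeAlgebra, FreeAlgebra.lift_ι_apply, toFreeAlgebra_gen])
    (UniversalEnvelopingAlgebra.algHom_ext_of_ι ℂ fun x => by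
      rw [AlgHom.comp_apply, toFreeAlgebra_ι, ofFreeAlgebra_coe, AlgHom.id_apply])

theorem bijective_ofFreeAlgebra : Function.Bijective (ofFreeAlgebra a) :=
  (uFreeLieEquiv a).symm.bijective

variable {a}

theorem uFreeLie_algHom_ext {A : Type*} [Ring A] [Algebra ℂ A] {f g : UFreeLie a →ₐ[ℂ] A}
    (h : ∀ x : Alphabet a, f (gen a x.1 x.2) = g (gen a x.1 x.2)) : f = g := by
  have h1 : f.comp (ofFreeAlgebra a) = g.comp (ofFreeAlgebra a) := by
    apply FreeAlgebra.hom_ext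
    funext x
    simp only [Function.comp_apply, AlgHom.comp_apply]
    rw [ofFreeAlgebra, FreeAlgebra.lift_ι_apply]
    exact h x
  refine AlgHom.ext fun u => ?_
  obtain ⟨w, rfl⟩ := (bijective_ofFreeAlgebra a).2 u
  exact DFunLike.congr_fun h1 w

theorem comul_gen (n : ℕ+) (i : Fin (a n)) :
    Coalgebra.comul (R := ℂ) (gen a n i) = gen a n i ⊗ₜ[ℂ] 1 + 1 ⊗ₜ[ℂ] gen a n i :=
  UniversalEnvelopingAlgebra.comulHom_ι ℂ _

theorem gen_mem_uFreeLiePart (n : ℕ+) (i : Fin (a n)) : gen a n i ∈ uFreeLiePart a n := by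
  refine Submodule.subset_span ⟨[((n : ℕ), ⟨FreeAlgebra.ι ℂ ⟨n, i⟩,
    LieSubalgebra.subset_lieSpan ⟨⟨n, i⟩, rfl⟩⟩)], ?_, by simp, ?_⟩
  · intro q hq
    rw [List.mem_singleton] at hq
    subst hq
    exact Submodule.subset_span ⟨[⟨n, i⟩], by simp, by simp; rfl⟩
  · rw [List.map_singleton, List.prod_singleton]
    rfl

variable {H : Type*} [Ring H] [HopfAlgebra ℂ H] {𝒜 : ℕ → Submodule ℂ H}

/-- A graded Hopf algebra isomorphism maps the generators to an ordered primitive generating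
set. -/
theorem gradedIso_gen_mem_OPG {φ : UFreeLie a ≃ₐc[ℂ] H} (hφ : φ ∈ gradedIso 𝒜 a) :
    (⟨a, fun n i => φ (gen a n i)⟩ : TupleSeq H) ∈ OPG 𝒜 := by
  refine ⟨fun n i => ⟨?_, hφ n _ (gen_mem_uFreeLiePart n i)⟩, ?_⟩
  · change Coalgebra.comul (R := ℂ) (φ (gen a n i)) = _
    rw [← CoalgHomClass.map_comp_comul_apply, comul_gen, map_add, TensorProduct.map_tmul,
      TensorProduct.map_tmul]
    simp
  · have h : FreeAlgebra.lift ℂ (fun x : Alphabet a => φ (gen a x.1 x.2)) =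
        ((φ : UFreeLie a ≃ₐ[ℂ] H) : UFreeLie a →ₐ[ℂ] H).comp (ofFreeAlgebra a) := by
      apply FreeAlgebra.hom_ext
      funext x
      simp only [Function.comp_apply, AlgHom.comp_apply, FreeAlgebra.lift_ι_apply]
      rw [ofFreeAlgebra, FreeAlgebra.lift_ι_apply]
      rfl
    change Function.Bijective (FreeAlgebra.lift ℂ fun x : Alphabet a => φ (gen a x.1 x.2))
    rw [h]
    exact (EquivLike.bijective φ).comp (bijective_ofFreeAlgebra a)

/-- Homogeneous primitive free generators define a graded Hopf algebra isomorphism. -/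
theorem exists_gradedIso [GradedAlgebra 𝒜] {g : Alphabet a → H}
    (hg : ∀ x, g x ∈ primPart 𝒜 (letterDeg a x))
    (hfree : Function.Bijective (FreeAlgebra.lift ℂ g)) :
    ∃ φ ∈ gradedIso 𝒜 a, ∀ x : Alphabet a, φ (gen a x.1 x.2) = g x := by
  let e : UFreeLie a ≃ₐ[ℂ] H :=
    (uFreeLieEquiv a).trans (AlgEquiv.ofBijective (FreeAlgebra.lift ℂ g) hfree)
  have he : ∀ u, e u = FreeAlgebra.lift ℂ g (toFreeAlgebra a u) := fun u => rfl
  have hgen : ∀ x : Alphabet a, e (gen a x.1 x.2) = g x := fun x => by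
    rw [he, toFreeAlgebra_gen, FreeAlgebra.lift_ι_apply]
  let φ : UFreeLie a ≃ₐc[ℂ] H := BialgEquiv.ofAlgEquiv e
    (uFreeLie_algHom_ext fun x => by
      simp only [AlgHom.comp_apply]
      refine (congrArg _ (hgen x)).trans ((counit_of_comul (hg x).1).trans ?_)
      exact (UniversalEnvelopingAlgebra.counitHom_ι ℂ _).symm)
    (uFreeLie_algHom_ext fun x => by
      simp only [AlgHom.comp_apply]
      have h1 : Coalgebra.comul (R := ℂ) (g x) = _ := (hg x).1
      have h2 := comul_gen (a := a) x.1 x.2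
      refine Eq.trans ?_ ((congrArg _ (hgen x)).trans h1).symm
      refine (congrArg _ h2).trans ?_
      rw [map_add, Algebra.TensorProduct.map_tmul, Algebra.TensorProduct.map_tmul, map_one]
      exact congrArg₂ (· + ·) (congrArg (· ⊗ₜ[ℂ] 1) (hgen x)) (congrArg (1 ⊗ₜ[ℂ] ·) (hgen x)))
  refine ⟨φ, fun n u hu => ?_, hgen⟩
  have hword : ∀ d, ∀ x ∈ wordPart a d, FreeAlgebra.lift ℂ g x ∈ 𝒜 d := by
    intro d x hx
    have : wordPart a d ≤ (𝒜 d).comap (FreeAlgebra.lift ℂ g).toLinearMap := by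
      rw [wordPart, Submodule.span_le]
      rintro _ ⟨w, rfl, rfl⟩
      change FreeAlgebra.lift ℂ g (wordProd _ w) ∈ 𝒜 _
      rw [lift_wordProd_ι]
      exact wordProd_mem 𝒜 (fun x => (hg x).2) w
    exact this hx
  have hle : uFreeLiePart a n ≤ (𝒜 n).comap e.toLinearMap := by
    rw [uFreeLiePart, UniversalEnvelopingAlgebra.gradedPart, Submodule.span_le]
    rintro _ ⟨l, hl, rfl, rfl⟩
    rw [SetLike.mem_coe, Submodule.mem_comap, AlgEquiv.toLinearMap_apply, map_list_prod,
      List.map_map]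
    refine SetLike.list_prod_map_mem_graded l _ _ fun q hq => ?_
    rw [Function.comp_apply, he, toFreeAlgebra_ι]
    exact hword _ _ (hl q hq)
  exact hle hu

end Enveloping

/-! ### Coordinates of ordered primitive generating sets -/

section Concat

variable {V : Type*}

/-- The index set of a concatenation as a disjoint union. -/
def concatEquiv {a p : ℕ} (hap : a ≤ p) : Fin a ⊕ Fin (p - a) ≃ Fin p :=
  finSumFinEquiv.trans (finCongr (Nat.add_sub_cancel' hap))

theorem concat_comp_concatEquiv {a p : ℕ} (hap : a ≤ p) (α : Fin a → V) (v : Fin (p - a) → V) :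
    concat α v ∘ concatEquiv hap = Sum.elim α v := by
  funext x
  rcases x with i | k
  · have : ((concatEquiv hap (Sum.inl i) : Fin p) : ℕ) < a := i.2
    simp only [Function.comp_apply, concat, dif_pos this, Sum.elim_inl]
    rfl
  · have h1 : ((concatEquiv hap (Sum.inr k) : Fin p) : ℕ) = a + k := rfl
    have : ¬ ((concatEquiv hap (Sum.inr k) : Fin p) : ℕ) < a := by omega
    simp only [Function.comp_apply, concat, dif_neg this, Sum.elim_inr]
    congr 1
    ext
    simp only [h1]
    omega

theorem range_concat {a p : ℕ} (hap : a ≤ p) (α : Fin a → V) (v : Fin (p - a) → V) :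
    Set.range (concat α v) = Set.range α ∪ Set.range v := by
  rw [← Set.Sum.elim_range, ← concat_comp_concatEquiv hap, EquivLike.range_comp]

theorem sum_smul_concat {K : Type*} [Semiring K] [AddCommMonoid V] [Module K V] {a p : ℕ}
    (hap : a ≤ p) (α : Fin a → V) (v : Fin (p - a) → V) (c : Fin p → K) :
    ∑ j, c j • concat α v j = ∑ i, c (Fin.castLE hap i) • α i +
      ∑ k, c (concatEquiv hap (Sum.inr k)) • v k := by
  have h : ∀ x, concat α v (concatEquiv hap x) = Sum.elim α v x :=
    congrFun (concat_comp_concatEquiv hap α v)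
  rw [← (concatEquiv hap).sum_comp, Fintype.sum_sum_type]
  simp only [h, Sum.elim_inl, Sum.elim_inr]
  rfl

end Concat

theorem image_letters {V : Type*} {a : ℕ+ → ℕ} (g : Alphabet a → V) (n : ℕ+) :
    g '' {x | letterDeg a x = n} = Set.range fun i => g ⟨n, i⟩ := by
  ext z
  constructor
  · rintro ⟨⟨m, i⟩, h, rfl⟩
    obtain rfl : m = n := PNat.coe_injective h
    exact ⟨i, rfl⟩
  · rintro ⟨i, rfl⟩
    exact ⟨⟨n, i⟩, rfl, rfl⟩

section Coordinates

variable {H : Type*} [Ring H] [HopfAlgebra ℂ H] {𝒜 : ℕ → Submodule ℂ H}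

theorem sum_derived_mem {q : ℕ} {n : ℕ} (v : Fin q → derivedPart 𝒜 n) (c : Fin q → ℂ) :
    ∑ k, c k • (v k : H) ∈ derivedPart 𝒜 n :=
  Submodule.sum_mem _ fun k _ => Submodule.smul_mem _ _ (v k).2

variable [GradedAlgebra 𝒜] {a : ℕ+ → ℕ} {g : Alphabet a → H}

theorem span_letters_sup_derivedPart (hg : ∀ x, g x ∈ primPart 𝒜 (letterDeg a x))
    (hfree : Function.Bijective (FreeAlgebra.lift ℂ g)) (n : ℕ+) :
    Submodule.span ℂ (Set.range fun i => g ⟨n, i⟩) ⊔ derivedPart 𝒜 n = primPart 𝒜 n := by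
  refine le_antisymm (sup_le (Submodule.span_le.2 ?_) (derivedPart_le_primPart _)) ?_
  · rintro _ ⟨i, rfl⟩
    exact hg ⟨n, i⟩
  · rw [← image_letters]
    exact primPart_le_letters_sup_derivedPart hg hfree n.pos

theorem disjoint_letters_derivedPart (hg : ∀ x, g x ∈ primPart 𝒜 (letterDeg a x))
    (hfree : Function.Bijective (FreeAlgebra.lift ℂ g)) (n : ℕ+) :
    Disjoint (Submodule.span ℂ (Set.range fun i => g ⟨n, i⟩)) (derivedPart 𝒜 n) := by
  obtain ⟨hli, hs⟩ := (bijective_lift_iff (K := ℂ) g).1 hfree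
  refine (disjoint_span_decPart 𝒜 (fun x => (hg x).2) hli hs n).mono (Submodule.span_mono ?_)
    (derivedPart_le_decPart (gradedPart_zero_le 𝒜 letterDeg_pos (fun x => (hg x).2) hs) n)
  rintro _ ⟨i, rfl⟩
  exact ⟨⟨n, i⟩, rfl⟩

theorem linearIndependent_letters_fiber (hfree : Function.Bijective (FreeAlgebra.lift ℂ g))
    (n : ℕ+) : LinearIndependent ℂ fun i => g ⟨n, i⟩ :=
  (linearIndependent_letters ((bijective_lift_iff (K := ℂ) g).1 hfree).1).comp
    (fun i => (⟨n, i⟩ : Alphabet a)) fun i j h => by simpa using h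

/-- The generators of degree `n` span a complement of `[P(H), P(H)]_n` in `P(H)_n`. -/
theorem finrank_primPart (hfin : ∀ n, Module.Finite ℂ (𝒜 n))
    (hg : ∀ x, g x ∈ primPart 𝒜 (letterDeg a x))
    (hfree : Function.Bijective (FreeAlgebra.lift ℂ g)) (n : ℕ+) :
    a n + Module.finrank ℂ (derivedPart 𝒜 n) = Module.finrank ℂ (primPart 𝒜 n) := by
  have := finite_primPart hfin n
  have h1 : Module.Finite ℂ (derivedPart 𝒜 n) :=
    Submodule.finiteDimensional_of_le (derivedPart_le_primPart n)
  have h2 : Module.Finite ℂ (Submodule.span ℂ (Set.range fun i => g ⟨n, i⟩)) :=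
    Module.Finite.span_of_finite ℂ (Set.finite_range _)
  have h := Submodule.finrank_sup_add_finrank_inf_eq
    (Submodule.span ℂ (Set.range fun i => g ⟨n, i⟩)) (derivedPart 𝒜 n)
  rw [span_letters_sup_derivedPart hg hfree, (disjoint_letters_derivedPart hg hfree n).eq_bot,
    finrank_bot, add_zero, finrank_span_eq_card (linearIndependent_letters_fiber hfree n),
    Fintype.card_fin] at h
  exact h.symm

/-- A primitive family with invertible leading coordinate matrices generates freely. -/
theorem bijective_lift_of_leadingMinor (hfin : ∀ n, Module.Finite ℂ (𝒜 n))
    (hg : ∀ x, g x ∈ primPart 𝒜 (letterDeg a x))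
    (hfree : Function.Bijective (FreeAlgebra.lift ℂ g)) {f : Alphabet a → H}
    (hf : ∀ x, f x ∈ primPart 𝒜 (letterDeg a x))
    (N : ∀ n : ℕ+, Matrix (Fin (a n)) (Fin (a n)) ℂ) (hN : ∀ n, (N n).det ≠ 0)
    (h : ∀ (n : ℕ+) i, f ⟨n, i⟩ - ∑ j, N n i j • g ⟨n, j⟩ ∈ derivedPart 𝒜 n) :
    Function.Bijective (FreeAlgebra.lift ℂ f) := by
  have h0 := gradedPart_zero_le 𝒜 letterDeg_pos (fun x => (hg x).2)
    ((bijective_lift_iff (K := ℂ) g).1 hfree).2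
  refine bijective_lift_of_span_decPart hfin (fun x => (hg x).2) hfree (fun x => (hf x).2) ?_
  rintro ⟨n, i⟩
  -- invert the matrix to express the old generators by the new ones
  have hinv : (N n)⁻¹ * N n = 1 := Matrix.nonsing_inv_mul _ (isUnit_iff_ne_zero.2 (hN n))
  have key : g ⟨n, i⟩ = ∑ l, (N n)⁻¹ i l • f ⟨n, l⟩ -
      ∑ l, (N n)⁻¹ i l • (f ⟨n, l⟩ - ∑ j, N n l j • g ⟨n, j⟩) := by
    have h1 : ∑ l, (N n)⁻¹ i l • ∑ j, N n l j • g ⟨n, j⟩ = g ⟨n, i⟩ := by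
      simp only [Finset.smul_sum, smul_smul]
      rw [Finset.sum_comm]
      simp only [← Finset.sum_smul, ← Matrix.mul_apply, hinv, Matrix.one_apply, ite_smul, one_smul,
        zero_smul, Finset.sum_ite_eq, Finset.mem_univ, if_true]
    simp only [smul_sub, Finset.sum_sub_distrib, sub_sub_cancel, h1]
  rw [key]
  refine Submodule.sub_mem _ (Submodule.mem_sup_left (Submodule.sum_mem _ fun l _ =>
    Submodule.smul_mem _ _ (Submodule.subset_span ⟨⟨n, l⟩, rfl, rfl⟩)))
    (Submodule.mem_sup_right (Submodule.sum_mem _ fun l _ => Submodule.smul_mem _ _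
      (derivedPart_le_decPart h0 n (h n l))))

/-- The leading coordinate matrices of a free primitive generating family are invertible. -/
theorem det_ne_zero_of_bijective_lift {f : Alphabet a → H}
    (hf : ∀ x, f x ∈ primPart 𝒜 (letterDeg a x))
    (hfree : Function.Bijective (FreeAlgebra.lift ℂ f)) {n : ℕ+}
    {N : Matrix (Fin (a n)) (Fin (a n)) ℂ}
    (h : ∀ i, f ⟨n, i⟩ - ∑ j, N i j • g ⟨n, j⟩ ∈ derivedPart 𝒜 n) : N.det ≠ 0 := by
  intro hdet
  obtain ⟨c, hc, hcN⟩ := Matrix.exists_vecMul_eq_zero_iff.2 hdet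
  have h1 : ∑ i, c i • ∑ j, N i j • g ⟨n, j⟩ = 0 := by
    simp only [Finset.smul_sum, smul_smul]
    rw [Finset.sum_comm]
    refine Finset.sum_eq_zero fun j _ => ?_
    rw [← Finset.sum_smul]
    have : ∑ i, c i * N i j = 0 := congrFun hcN j
    rw [this, zero_smul]
  have h2 : ∑ i, c i • f ⟨n, i⟩ ∈ derivedPart 𝒜 n := by
    rw [← sub_zero (∑ i, c i • f ⟨n, i⟩), ← h1, ← Finset.sum_sub_distrib]
    simp only [← smul_sub]
    exact Submodule.sum_mem _ fun i _ => Submodule.smul_mem _ _ (h i)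
  have h3 : ∑ i, c i • f ⟨n, i⟩ = 0 :=
    Submodule.disjoint_def.1 (disjoint_letters_derivedPart hf hfree n) _
      (Submodule.sum_mem _ fun i _ => Submodule.smul_mem _ _ (Submodule.subset_span ⟨i, rfl⟩)) h2
  exact hc (funext fun i =>
    Fintype.linearIndependent_iff.1 (linearIndependent_letters_fiber hfree n) c h3 i)

end Coordinates

end FreeHopf

theorem mainTheorem4 {H : Type*} [Ring H] [HopfAlgebra ℂ H]
    (𝒜 : ℕ → Submodule ℂ H) [GradedAlgebra 𝒜] (hH : FreeHopf.IsFGCCHA 𝒜)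
    (hfin : ∀ n, Module.Finite ℂ (𝒜 n)) :
    ∃ (a p : ℕ+ → ℕ) (hap : ∀ n, a n ≤ p n),
      FreeHopf.SequenceTriple (fun n => Module.finrank ℂ (𝒜 n)) a p ∧
      -- the bijection `Γ`, `φ ↦ φ(X_a)`
      Set.BijOn
        (fun φ : FreeHopf.UFreeLie a ≃ₐc[ℂ] H =>
          (⟨a, fun n i => φ (FreeHopf.gen a n i)⟩ : FreeHopf.TupleSeq H))
        (FreeHopf.gradedIso 𝒜 a) (FreeHopf.OPG 𝒜) ∧
      -- the choices on which the bijection `Ξ` depends exist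
      (FreeHopf.OPG 𝒜).Nonempty ∧
      (∀ n : ℕ+, Nonempty
        (Module.Basis (Fin (p n - a n)) ℂ (FreeHopf.derivedPart 𝒜 n))) ∧
      -- and each of them gives a bijection `Ξ`, which maps `B` to its coordinate matrices
      ∀ α : ∀ n : ℕ+, Fin (a n) → H, (⟨a, α⟩ : FreeHopf.TupleSeq H) ∈ FreeHopf.OPG 𝒜 →
      ∀ v : ∀ n : ℕ+, Module.Basis (Fin (p n - a n)) ℂ (FreeHopf.derivedPart 𝒜 n),
        (∀ n : ℕ+,
          LinearIndependent ℂ (FreeHopf.concat (p := p n) (α n) fun k => (v n k : H)) ∧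
          Submodule.span ℂ
              (Set.range (FreeHopf.concat (p := p n) (α n) fun k => (v n k : H))) =
            FreeHopf.primPart 𝒜 n) ∧
        ∃ Ξ : FreeHopf.OPG 𝒜 ≃ FreeHopf.LeadingMinorNonzero hap,
          ∀ B : FreeHopf.OPG 𝒜, (B : FreeHopf.TupleSeq H) =
            ⟨a, fun n i => ∑ j, (Ξ B).1 n i j •
              FreeHopf.concat (p := p n) (α n) (fun k => (v n k : H)) j⟩ := by
  classical
  obtain ⟨X, hX, hXfree⟩ := hH.free
  obtain ⟨a, g, hg, hgfree⟩ := FreeHopf.exists_alphabet 𝒜 hfin hX hXfree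
  obtain ⟨f, hf, hffree⟩ := FreeHopf.exists_primitive_gens hH hfin hg hgfree
  have hs := ((FreeHopf.bijective_lift_iff (K := ℂ) f).1 hffree).2
  have h0 := FreeHopf.gradedPart_zero_le 𝒜 FreeHopf.letterDeg_pos (fun x => (hf x).2) hs
  have hrank := FreeHopf.finrank_primPart hfin hf hffree
  set p : ℕ+ → ℕ := fun n => Module.finrank ℂ (FreeHopf.primPart 𝒜 n) with hp
  have hap : ∀ n, a n ≤ p n := fun n => Nat.le.intro (hrank n)
  -- every ordered primitive generating set has the shape `a`
  have hlen : ∀ B ∈ FreeHopf.OPG 𝒜, B.1 = a := fun B hB =>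
    FreeHopf.card_gens_unique hfin hg hgfree (f := fun x => B.2 x.1 x.2)
      (fun x => (hB.1 x.1 x.2).2) hB.2
  refine ⟨a, p, hap, ⟨FreeHopf.one_add_genFun_finrank hfin hg hgfree,
    FreeHopf.coeff_one_add_genFun_finrank hfin h0 FreeHopf.letterDeg_pos hf hs⟩,
    ⟨fun φ hφ => FreeHopf.gradedIso_gen_mem_OPG hφ, fun φ _ ψ _ h => ?_, ?_⟩,
    ⟨⟨a, fun n i => f ⟨n, i⟩⟩, fun n i => hf ⟨n, i⟩, hffree⟩, fun n => ?_, fun α hα v => ?_⟩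
  · have h1 : (fun n i => φ (FreeHopf.gen a n i)) = fun n i => ψ (FreeHopf.gen a n i) :=
      eq_of_heq (Sigma.mk.inj_iff.1 h).2
    have h2 : ((φ : FreeHopf.UFreeLie a ≃ₐ[ℂ] H) : FreeHopf.UFreeLie a →ₐ[ℂ] H) =
        ((ψ : FreeHopf.UFreeLie a ≃ₐ[ℂ] H) : FreeHopf.UFreeLie a →ₐ[ℂ] H) :=
      FreeHopf.uFreeLie_algHom_ext fun x => congrFun (congrFun h1 x.1) x.2
    exact BialgEquiv.ext fun u => DFunLike.congr_fun h2 u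
  · rintro ⟨b, β⟩ hB
    obtain rfl : b = a := hlen _ hB
    obtain ⟨φ, hφ, hφg⟩ := FreeHopf.exists_gradedIso (g := fun x => β x.1 x.2)
      (fun x => hB.1 x.1 x.2) hB.2
    exact ⟨φ, hφ, Sigma.ext rfl (heq_of_eq (funext fun n => funext fun i => hφg ⟨n, i⟩))⟩
  · have := FreeHopf.finite_primPart hfin n
    have h1 : Module.Finite ℂ (FreeHopf.derivedPart 𝒜 n) :=
      Submodule.finiteDimensional_of_le (FreeHopf.derivedPart_le_primPart n)
    exact ⟨Module.finBasisOfFinrankEq ℂ _ (Nat.eq_sub_of_add_eq' (hrank n))⟩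
  · let α' : FreeHopf.Alphabet a → H := fun x => α x.1 x.2
    have hα' : ∀ x, α' x ∈ FreeHopf.primPart 𝒜 (FreeHopf.letterDeg a x) :=
      fun x => hα.1 x.1 x.2
    have hαfree : Function.Bijective (FreeAlgebra.lift ℂ α') := hα.2
    have hvspan : ∀ n : ℕ+, Submodule.span ℂ (Set.range fun k => (v n k : H)) =
        FreeHopf.derivedPart 𝒜 n := by
      intro n
      have h1 := congrArg (Submodule.map (FreeHopf.derivedPart 𝒜 n).subtype) (v n).span_eq
      rw [Submodule.map_span, ← Set.range_comp, Submodule.map_subtype_top] at h1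
      exact h1
    have hspan : ∀ n : ℕ+, Submodule.span ℂ
        (Set.range (FreeHopf.concat (p := p n) (α n) fun k => (v n k : H))) =
          FreeHopf.primPart 𝒜 n := by
      intro n
      rw [FreeHopf.range_concat (hap n), Submodule.span_union, hvspan]
      exact FreeHopf.span_letters_sup_derivedPart hα' hαfree n
    have hli : ∀ n : ℕ+, LinearIndependent ℂ
        (FreeHopf.concat (p := p n) (α n) fun k => (v n k : H)) := by
      intro n
      -- a spanning family of `P(H)_n` with `p n = dim P(H)_n` members
      rw [linearIndependent_iff_card_eq_finrank_span, Set.finrank, hspan, Fintype.card_fin]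
    refine ⟨fun n => ⟨hli n, hspan n⟩, ?_⟩
    -- the inverse of `Ξ` maps matrices to the elements with these coordinates
    let β : (∀ n : ℕ+, Matrix (Fin (a n)) (Fin (p n)) ℂ) → ∀ n : ℕ+, Fin (a n) → H :=
      fun M n i => ∑ j, M n i j • FreeHopf.concat (p := p n) (α n) (fun k => (v n k : H)) j
    have hβ : ∀ M (n : ℕ+) i, β M n i ∈ FreeHopf.primPart 𝒜 n := fun M n i => by
      rw [← hspan n]
      exact Submodule.sum_mem _ fun j _ => Submodule.smul_mem _ _ (Submodule.subset_span ⟨j, rfl⟩)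
    have hlead : ∀ M (n : ℕ+) i, β M n i -
        ∑ j, ((M n).submatrix id (Fin.castLE (hap n))) i j • α' ⟨n, j⟩ ∈
          FreeHopf.derivedPart 𝒜 n := fun M n i => by
      have : β M n i = _ := FreeHopf.sum_smul_concat (hap n) (α n) (fun k => (v n k : H)) (M n i)
      rw [this]
      simp only [Matrix.submatrix_apply, id, α', add_sub_cancel_left]
      exact FreeHopf.sum_derived_mem _ _
    let Φ : FreeHopf.LeadingMinorNonzero hap → FreeHopf.OPG 𝒜 := fun M =>
      ⟨⟨a, β M.1⟩, hβ M.1, FreeHopf.bijective_lift_of_leadingMinor (f := fun x => β M.1 x.1 x.2)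
        hfin hα' hαfree (fun x => hβ M.1 x.1 x.2) _ M.2 (hlead M.1)⟩
    have hΦ : Function.Bijective Φ := by
      constructor
      · intro M M' h
        have h1 : β M.1 = β M'.1 :=
          eq_of_heq (Sigma.mk.inj_iff.1 (congrArg Subtype.val h)).2
        refine Subtype.ext (funext fun n => funext fun i => ?_)
        exact (hli n).fintypeLinearCombination_injective (congrFun (congrFun h1 n) i)
      · rintro ⟨⟨b, γ⟩, hB⟩
        obtain rfl : b = a := hlen _ hB
        have h1 : ∀ n i, ∃ c : Fin (p n) → ℂ,
            ∑ j, c j • FreeHopf.concat (p := p n) (α n) (fun k => (v n k : H)) j = γ n i := by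
          intro n i
          have h2 := hB.1 n i
          rw [← hspan n] at h2
          exact (Submodule.mem_span_range_iff_exists_fun ℂ).1 h2
        choose M hM using h1
        have hβM : β M = γ := funext fun n => funext fun i => hM n i
        refine ⟨⟨M, fun n => ?_⟩, Subtype.ext (Sigma.ext rfl (heq_of_eq hβM))⟩
        refine FreeHopf.det_ne_zero_of_bijective_lift (f := fun x => γ x.1 x.2) (g := α')
          (fun x => hB.1 x.1 x.2) hB.2 fun i => ?_
        rw [← hβM]
        exact hlead M n i
    exact ⟨(Equiv.ofBijective Φ hΦ).symm, fun B =>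
      (congrArg Subtype.val ((Equiv.ofBijective Φ hΦ).apply_symm_apply B)).symm⟩
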